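/- Let $d,T,\beta,\gamma,\eta,r>0$, $\sigma\in\mathbb{R}$, and let $b\in L^2([-d,0];\mathbb{R}_+)$. Consider the mean field game in which the representative firm, with production level $$dk(t)=\Big[\alpha(t)+\int_{-d}^0 b(\xi)\alpha(t+\xi)\,d\xi\Big]dt+\sigma\,dW(t),\qquad 0\le t\le T,$$ minimizes, given the population distribution $\nu$ of production levels, with $\bar\nu(t):=\int_{\mathbb{R}}\xi\,\nu(t,d\xi)$, $$\frac12\,\mathbb{E}\Big[\int_0^T\big[(k(t)-\beta\eta+\beta\gamma\bar\nu(t))^2+r\alpha(t)^2\big]dt+(k(T)-\beta\eta+\beta\gamma\bar\nu(T))^2\Big].$$ Reformulate it in the Hilbert space $H=\mathbb{R}\times L^2(-d,0)$, with $\langle x,y\rangle=x_0y_0+\int_{-d}^0x_1y_1\,d\xi$, as follows. Let $A(x_0,x_1)=(x_1(0),-x_1')$ with domain $D(A)=\{(x_0,x_1)\in H: x_1\in W^{1,2}(-d,0),\ x_1(-d)=0\}$. Put $B:\mathbb{R}\to H$, $B\alpha=(1,b)\alpha$; $G:\mathbb{R}\to H$, $Gw=(\sigma w,0)$; $R=r$;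 $\overline Qx=(x_0,0)$; $S=-\beta\gamma I$; $n=(\beta\eta,0)\in H$. Let $m_0$ be a Borel probability measure on $H$ with $\int_H|x|\,m_0(dx)<\infty$, and let $z_0=\int_H x\,m_0(dx)$ be its mean. Then $A$ generates a $C_0$-semigroup $(e^{tA})_{t\ge0}$ on $H$, and, with $e^{tA^*}=(e^{tA})^*$, there is exactly one LQM (linear-quadratic-mean) mild solution of the game. That is, there is exactly one quadruple $(P,\mathbf r,z,s)$ of functions on $[0,T]$ such that $P$ takes values in the nonnegative self-adjoint bounded operators on $H$ and is strongly continuous, $\mathbf r,z\in C([0,T];H)$, $s\in C([0,T];\mathbb{R})$, and for all $t\in[0,T]$ and $x\in H$: $$P(t)x=e^{(T-t)A^*}\overline Qe^{(T-t)A}x+\int_t^Te^{(\tau-t)A^*}\overline Qe^{(\tau-t)A}x\,d\tau-\int_t^Te^{(\tau-t)A^*}P(\tau)BR^{-1}B^*P(\tau)e^{(\tau-t)A}x\,d\tau,$$ $$z(t)=e^{tA}z_0-\int_0^te^{(t-\tau)A}BR^{-1}B^*P(\tau)z(\tau)\,d\tau-\int_0^te^{(t-\tau)A}BR^{-1}B^*\mathbf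 r(\tau)\,d\tau,$$ $$\mathbf r(t)=e^{(T-t)A^*}\big(-\overline QSz(T)-n\big)-\int_t^Te^{(\tau-t)A^*}P(\tau)BR^{-1}B^*\mathbf r(\tau)\,d\tau-\int_t^Te^{(\tau-t)A^*}\big(\overline QSz(\tau)+n\big)\,d\tau,$$ $$s(t)=\tfrac12\big(\beta\eta-\beta\gamma z(T)_0\big)^2+\int_t^T\Big[\tfrac12\mathrm{Tr}[GG^*P(\tau)]-\tfrac12\langle BR^{-1}B^*\mathbf r(\tau),\mathbf r(\tau)\rangle+\tfrac12\big(\beta\eta-\beta\gamma z(\tau)_0\big)^2\Big]d\tau,$$ where $y_0$ denotes the $\mathbb{R}$-component of $y\in H$. -/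

import Mathlib

open MeasureTheory Filter Topology Set
open scoped ContDiff InnerProductSpace

noncomputable section

/-! ### Strongly continuous semigroups -/

/-- `E` restricted to `[0,∞)` is a `C₀`-semigroup of bounded operators on `H`
(the values `E t` for `t < 0` play no role). -/
structure IsC0Semigroup {H : Type*} [NormedAddCommGroup H] [NormedSpace ℝ H]
    (E : ℝ → H →L[ℝ] H) : Prop where
  map_zero : E 0 = ContinuousLinearMap.id ℝ H
  map_add : ∀ s t : ℝ, 0 ≤ s → 0 ≤ t → E (s + t) = (E s).comp (E t)
  continuousOn : ∀ x : H, ContinuousOn (fun t => E t x) (Ici 0)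

/-- The unbounded operator whose graph is `Γ` (`Γ x y` means `x ∈ D(A)` and `A x = y`) is the
infinitesimal generator of `E`: `x ∈ D(A)` and `A x = y` if and only if `(E h x - x) / h → y`
as `h ↓ 0`. -/
def IsGeneratorGraph {H : Type*} [NormedAddCommGroup H] [NormedSpace ℝ H]
    (E : ℝ → H →L[ℝ] H) (Γ : H → H → Prop) : Prop :=
  ∀ x y : H, Γ x y ↔ Tendsto (fun h : ℝ => h⁻¹ • (E h x - x)) (𝓝[>] 0) (𝓝 y)

/-! ### Linear-quadratic-mean (LQM) mild solutions -/

/-- The trace `∑ᵢ ⟨eᵢ, L eᵢ⟩` of an operator, computed in a Hilbert basis of `H`. -/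
def opTrace {H : Type*} [NormedAddCommGroup H] [InnerProductSpace ℝ H] [CompleteSpace H]
    (L : H →L[ℝ] H) : ℝ :=
  ∑' e : ↥(exists_hilbertBasis ℝ H).choose, ⟪(e : H), L (e : H)⟫_ℝ

/-- Coefficients, apart from the operator `A`, of a linear-quadratic mean field game with state
equation `dX = (A X + B α) ds + σ dW`, running cost
`½ (⟨R α, α⟩ + ⟨Q x, x⟩ + ⟨Qbar (x - S z), x - S z⟩) + ⟨ℓ, x⟩ + c z` and terminal cost
`½ (⟨QT x, x⟩ + ⟨QbarT (x - ST z), x - ST z⟩) + ⟨ℓT, x⟩ + cT z`,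
where `z` is the mean of the population. -/
structure LQMData (H U K : Type*) [NormedAddCommGroup H] [InnerProductSpace ℝ H]
    [NormedAddCommGroup U] [InnerProductSpace ℝ U]
    [NormedAddCommGroup K] [InnerProductSpace ℝ K] where
  B : U →L[ℝ] H
  R : U →L[ℝ] U
  Q : H →L[ℝ] H
  QT : H →L[ℝ] H
  Qbar : H →L[ℝ] H
  QbarT : H →L[ℝ] H
  S : H →L[ℝ] H
  ST : H →L[ℝ] H
  σ : K →L[ℝ] H
  ℓ : H
  ℓT : H
  c : H → ℝ
  cT : H → ℝ

namespace LQMData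

variable {H U K : Type*} [NormedAddCommGroup H] [InnerProductSpace ℝ H] [CompleteSpace H]
  [NormedAddCommGroup U] [InnerProductSpace ℝ U] [CompleteSpace U]
  [NormedAddCommGroup K] [InnerProductSpace ℝ K] [CompleteSpace K]

/-- The operator `B R⁻¹ B*`. -/
def BRB (D : LQMData H U K) : H →L[ℝ] H :=
  D.B ∘L D.R.inverse ∘L ContinuousLinearMap.adjoint D.B

/-- `P ∈ C_s([0,T]; Σ⁺(H))` is a mild solution of the backward Riccati equation
`P' + P A + A* P - P B R⁻¹ B* P + Q + Qbar = 0`, `P(T) = QT + QbarT`; `E t` stands for `e^{tA}`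
and its adjoint for `e^{tA*}`. -/
structure IsMildRiccati (D : LQMData H U K) (E : ℝ → H →L[ℝ] H) (T : ℝ)
    (P : ℝ → H →L[ℝ] H) : Prop where
  isPositive : ∀ t ∈ Icc 0 T, (P t).IsPositive
  continuousOn : ∀ x : H, ContinuousOn (fun t => P t x) (Icc 0 T)
  eq : ∀ x : H, ∀ t ∈ Icc 0 T,
    P t x = ContinuousLinearMap.adjoint (E (T - t)) ((D.QT + D.QbarT) (E (T - t) x))
      + (∫ τ in t..T, ContinuousLinearMap.adjoint (E (τ - t)) ((D.Q + D.Qbar) (E (τ - t) x)))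
      - ∫ τ in t..T,
          ContinuousLinearMap.adjoint (E (τ - t)) (P τ (D.BRB (P τ (E (τ - t) x))))

/-- `(z, r) ∈ C([0,T]; H²)` is a mild solution of the forward-backward system
`z' = (A - B R⁻¹ B* P) z - B R⁻¹ B* r`, `z(0) = z₀`,
`r' + (A* - P B R⁻¹ B*) r - Qbar S z + ℓ = 0`, `r(T) = - QbarT ST z(T) + ℓT`. -/
structure IsMildForwardBackward (D : LQMData H U K) (E : ℝ → H →L[ℝ] H) (T : ℝ) (z₀ : H)
    (P : ℝ → H →L[ℝ] H) (z r : ℝ → H) : Prop where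
  continuousOn_z : ContinuousOn z (Icc 0 T)
  continuousOn_r : ContinuousOn r (Icc 0 T)
  eq_z : ∀ t ∈ Icc 0 T,
    z t = E t z₀ - (∫ τ in (0 : ℝ)..t, E (t - τ) (D.BRB (P τ (z τ))))
      - ∫ τ in (0 : ℝ)..t, E (t - τ) (D.BRB (r τ))
  eq_r : ∀ t ∈ Icc 0 T,
    r t = ContinuousLinearMap.adjoint (E (T - t)) (-D.QbarT (D.ST (z T)) + D.ℓT)
      - (∫ τ in t..T, ContinuousLinearMap.adjoint (E (τ - t)) (P τ (D.BRB (r τ))))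
      - ∫ τ in t..T, ContinuousLinearMap.adjoint (E (τ - t)) (D.Qbar (D.S (z τ)) - D.ℓ)

/-- `(P, r, z, s)` is an LQM mild solution of the mean field game: the value function is
`v(t,x) = ½ ⟨P(t) x, x⟩ + ⟨r(t), x⟩ + s(t)` and the mean of the population is `z(t)`. -/
structure IsLQMMildSolution (D : LQMData H U K) (E : ℝ → H →L[ℝ] H) (T : ℝ) (z₀ : H)
    (P : ℝ → H →L[ℝ] H) (r z : ℝ → H) (s : ℝ → ℝ) : Prop where
  riccati : D.IsMildRiccati E T P
  forwardBackward : D.IsMildForwardBackward E T z₀ P z r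
  continuousOn_s : ContinuousOn s (Icc 0 T)
  eq_s : ∀ t ∈ Icc 0 T,
    s t = 1 / 2 * ⟪D.QbarT (D.ST (z T)), D.ST (z T)⟫_ℝ + D.cT (z T)
      + ∫ τ in t..T,
          (1 / 2 * opTrace (D.σ ∘L ContinuousLinearMap.adjoint D.σ ∘L P τ)
            - 1 / 2 * ⟪D.BRB (r τ), r τ⟫_ℝ
            + 1 / 2 * ⟪D.Qbar (D.S (z τ)), D.S (z τ)⟫_ℝ + D.c (z τ))

end LQMData

/-! ### Production output planning with time-to-build delay -/

/-- `L²(-d,0)`. -/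
abbrev DelayL2 (d : ℝ) : Type := Lp ℝ 2 (volume.restrict (Icc (-d) 0))

/-- `H = ℝ × L²(-d,0)` with inner product `⟨x, y⟩ = x₀ y₀ + ∫ x₁ y₁`. -/
abbrev DelaySpace (d : ℝ) : Type := WithLp 2 (ℝ × DelayL2 d)

/-- `g` is the weak derivative of `f` on `(-d,0)`. -/
def IsWeakDeriv {d : ℝ} (f g : DelayL2 d) : Prop :=
  ∀ φ : ℝ → ℝ, ContDiff ℝ ∞ φ → tsupport φ ⊆ Ioo (-d) 0 →
    ∫ ξ in Icc (-d) 0, f ξ * deriv φ ξ = -∫ ξ in Icc (-d) 0, g ξ * φ ξ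

/-- The graph of the operator `A (x₀, x₁) = (x₁(0), -x₁')` with domain
`D(A) = {(x₀, x₁) : x₁ ∈ W^{1,2}(-d,0), x₁(-d) = 0}`; the boundary values are those of the
continuous representative `u` of `x₁`. -/
def delayOperatorGraph (d : ℝ) (x y : DelaySpace d) : Prop :=
  IsWeakDeriv x.snd (-y.snd) ∧
    ∃ u : ℝ → ℝ, ContinuousOn u (Icc (-d) 0) ∧
      (∀ᵐ ξ ∂(volume.restrict (Icc (-d) 0)), x.snd ξ = u ξ) ∧ u (-d) = 0 ∧ y.fst = u 0

/-- The operator `x ↦ (x₀, 0)` on `H`. -/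
def delayProj (d : ℝ) : DelaySpace d →L[ℝ] DelaySpace d :=
  (WithLp.prodContinuousLinearEquiv 2 ℝ ℝ (DelayL2 d)).symm.toContinuousLinearMap ∘L
    ContinuousLinearMap.inl ℝ ℝ (DelayL2 d) ∘L ContinuousLinearMap.fst ℝ ℝ (DelayL2 d) ∘L
      (WithLp.prodContinuousLinearEquiv 2 ℝ ℝ (DelayL2 d)).toContinuousLinearMap

/-- Coefficients of the production planning game: `B α = α (1, b)`, `G w = (σ w, 0)`, running cost
`½ ((x₀ - β η + β γ z₀)² + r α²)` and terminal cost `½ (x₀ - β η + β γ z₀)²`, where `z₀` is the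
mean of the `ℝ`-component. Expanding the square gives `Q = 0`, `Qbar x = (x₀, 0)`, `S = -β γ I`,
the linear term `-β η x₀` and the state-independent term `½ ((β η)² - 2 η β² γ z₀)`. -/
def productionData (d β γ η r σ : ℝ) (b : DelayL2 d) : LQMData (DelaySpace d) ℝ ℝ where
  B := ContinuousLinearMap.toSpanSingleton ℝ (WithLp.toLp 2 ((1 : ℝ), b))
  R := r • ContinuousLinearMap.id ℝ ℝ
  Q := 0
  QT := 0
  Qbar := delayProj d
  QbarT := delayProj d
  S := (-(β * γ)) • ContinuousLinearMap.id ℝ (DelaySpace d)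
  ST := (-(β * γ)) • ContinuousLinearMap.id ℝ (DelaySpace d)
  σ := ContinuousLinearMap.toSpanSingleton ℝ (WithLp.toLp 2 (σ, (0 : DelayL2 d)))
  ℓ := -WithLp.toLp 2 (β * η, (0 : DelayL2 d))
  ℓT := -WithLp.toLp 2 (β * η, (0 : DelayL2 d))
  c := fun z => 1 / 2 * ((β * η) ^ 2 - 2 * η * β ^ 2 * γ * z.fst)
  cT := fun z => 1 / 2 * ((β * η) ^ 2 - 2 * η * β ^ 2 * γ * z.fst)

end

/-! Two independent facts are needed: the delay operator generates a semigroup, and the Riccati and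
forward-backward equations are uniquely solvable on all of `[0,T]`.

Solvability is a Hilbert space argument for a `IsC0Semigroup` and rank-one data `Q = q ⊗ q`, `N = B
R⁻¹ B* = v ⊗ v`. For symmetric `P` the nonlinearity is `P N P = (P v) ⊗ (P v)`, so the Riccati
equation is governed by the single curve `f = P v`. Truncating the square of `f` gives a Lipschitz
Volterra equation, solvable globally (`exists_volterra_solution`). The a priori bounds `0 ≤ P ≤ c`,
which hold already for the truncated equation, then show that the truncation is never active
(`exists_riccati`). Uniqueness is Grönwall for `P v` (`riccati_unique`).

For the forward-backward system put `p = P z + r`. Then `P` disappears: `z' = A z - N p` and `p' +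
A* p + (1 + c) Q z + ℓ = 0` with `p(T) = (1 + c) Q z(T) + ℓ`, where `c = β γ`. Since `c ≥ 0` this is
the Hamiltonian system of a convex control problem. A second Riccati equation, with `(1 + c) Q`,
decouples it (`exists_coupled`), and pairing the difference of two solutions with itself gives
uniqueness without smallness of `T` (`coupled_unique`). The function `s` is then explicit, its trace
term being `⟨g, P g⟩`.

Mild solutions need not be differentiable, so the product rule and the duality formula (`mild_mul`,
`mild_duality`) are obtained from Fubini on a triangle. They also require strong continuity of the
adjoint semigroup (`continuous_adjoint_max`).

The semigroup itself is explicit: it translates `x₁` to the right, with zero inflow at `-d`, and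
adds to `x₀` the mass that leaves at `0`. Translation is nilpotent, so its generator is inverted by
minus the integral of the translates over `[0,d]`; this integral is the primitive from `-d`, which
matches the weak-derivative description of `D(A)`. -/

/-! ### Volterra integral equations -/

section Volterra

variable {X : Type*} [NormedAddCommGroup X] [NormedSpace ℝ X]

/-- Fubini's theorem on a triangle. -/
theorem intervalIntegral_triangle_swap {a b : ℝ} (hab : a ≤ b) {f : ℝ → ℝ → X}
    (hf : Integrable (Function.uncurry f)
      ((volume.restrict (Ioc a b)).prod (volume.restrict (Ioc a b)))) :
    ∫ τ in a..b, ∫ σ in a..τ, f τ σ = ∫ σ in a..b, ∫ τ in σ..b, f τ σ := by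
  have hm : MeasurableSet {p : ℝ × ℝ | p.2 ≤ p.1} := measurableSet_le measurable_snd measurable_fst
  have key := integral_integral_swap (f := fun τ σ => {p : ℝ × ℝ | p.2 ≤ p.1}.indicator
    (Function.uncurry f) (τ, σ)) (hf.indicator hm)
  rw [intervalIntegral.integral_of_le hab, intervalIntegral.integral_of_le hab]
  convert key using 1
  · refine setIntegral_congr_fun measurableSet_Ioc fun τ hτ => ?_
    have : (fun σ => {p : ℝ × ℝ | p.2 ≤ p.1}.indicator (Function.uncurry f) (τ, σ))
        = (Iic τ).indicator (f τ) := by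
      ext σ; by_cases h : σ ≤ τ <;> simp [indicator, h]
    rw [this, integral_indicator measurableSet_Iic, Measure.restrict_restrict measurableSet_Iic,
      intervalIntegral.integral_of_le hτ.1.le]
    congr 2
    ext σ
    simp only [mem_Ioc, mem_inter_iff, mem_Iic] at *
    exact ⟨fun h => ⟨h.2, h.1, h.2.trans hτ.2⟩, fun h => ⟨h.2.1, h.1⟩⟩
  · refine setIntegral_congr_fun measurableSet_Ioc fun σ hσ => ?_
    have : (fun τ => {p : ℝ × ℝ | p.2 ≤ p.1}.indicator (Function.uncurry f) (τ, σ))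
        = (Ici σ).indicator (fun τ => f τ σ) := by
      ext τ; by_cases h : σ ≤ τ <;> simp [indicator, h]
    -- This section of the triangle contains its left endpoint `σ`; hence the passage to `Icc`,
    -- which changes only a null set.
    rw [this, integral_indicator measurableSet_Ici, Measure.restrict_restrict measurableSet_Ici,
      intervalIntegral.integral_of_le hσ.2, ← integral_Icc_eq_integral_Ioc]
    congr 2
    ext τ
    simp only [mem_Ioc, mem_inter_iff, mem_Ici, mem_Icc] at *
    exact ⟨fun h => ⟨h.1, hσ.1.trans_le h.1, h.2⟩, fun h => ⟨h.1, h.2.2⟩⟩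

theorem Continuous.intervalIntegral_triangle_swap {a b : ℝ} (hab : a ≤ b) {f : ℝ → ℝ → X}
    (hf : Continuous (Function.uncurry f)) :
    ∫ τ in a..b, ∫ σ in a..τ, f τ σ = ∫ σ in a..b, ∫ τ in σ..b, f τ σ := by
  refine _root_.intervalIntegral_triangle_swap hab ?_
  rw [Measure.prod_restrict]
  exact (hf.continuousOn.integrableOn_compact (isCompact_Icc.prod isCompact_Icc)).mono_set
    (prod_mono Ioc_subset_Icc_self Ioc_subset_Icc_self)

theorem continuous_intervalIntegral_left {Y : Type*} [TopologicalSpace Y] [FirstCountableTopology Y]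
    [LocallyCompactSpace Y] {f : Y → ℝ → X}
    (hf : Continuous (Function.uncurry f)) {s : Y → ℝ} (hs : Continuous s) (b : ℝ) :
    Continuous fun y => ∫ τ in (s y)..b, f y τ := by
  simp_rw [intervalIntegral.integral_symm b]
  exact (intervalIntegral.continuous_parametric_intervalIntegral_of_continuous hf hs).neg

/-- Integral form of Grönwall's uniqueness lemma. -/
theorem eq_zero_of_norm_le_mul_integral {Y : Type*} [NormedAddCommGroup Y] {a b L : ℝ}
    {w : ℝ → Y}
    (hw : ContinuousOn w (Icc a b))
    (h : ∀ s ∈ Icc a b, ‖w s‖ ≤ L * ∫ τ in a..s, ‖w τ‖) : ∀ s ∈ Icc a b, w s = 0 := by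
  intro s hs
  have hab : a ≤ b := hs.1.trans hs.2
  have hwI : ∀ u ∈ Icc a b, ∀ v ∈ Icc a b, IntervalIntegrable (fun τ => ‖w τ‖) volume u v :=
    fun u hu v hv => (hw.norm.mono (uIcc_subset_Icc hu hv)).intervalIntegrable
  -- The primitive `W` of `‖w‖` satisfies `|W'| ≤ L |W|` and `W a = 0`. Right derivatives suffice,
  -- and `w` is continuous only on `[a,b]`.
  have hderiv : ∀ x ∈ Ico a b,
      HasDerivWithinAt (fun t => ∫ τ in a..t, ‖w τ‖) ‖w x‖ (Ici x) x := by
    intro x hx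
    have hx' : x ∈ Icc a b := ⟨hx.1, hx.2.le⟩
    have hc : ContinuousWithinAt (fun τ => ‖w τ‖) (Ioi x) x :=
      ((hw.norm x hx').mono_of_mem_nhdsWithin
        (mem_of_superset (Ioc_mem_nhdsGT hx.2) fun y hy => ⟨hx.1.trans hy.1.le, hy.2⟩))
    refine intervalIntegral.integral_hasDerivWithinAt_right
      (hwI a ⟨le_rfl, hab⟩ x hx') (s := Ici x) (t := Ioi x) ?_ hc
    exact ⟨Ioc x b, Ioc_mem_nhdsGT hx.2,
      ((hw.norm.mono fun y hy => ⟨hx.1.trans hy.1.le, hy.2⟩).aestronglyMeasurable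
        measurableSet_Ioc)⟩
  have hz : ∀ x ∈ Icc a b, (∫ τ in a..x, ‖w τ‖) = 0 := by
    refine eq_zero_of_abs_deriv_le_mul_abs_self_of_eq_zero_right (K := L)
      (f' := fun x => ‖w x‖) ?_ hderiv (by simp) ?_
    · have := intervalIntegral.continuousOn_primitive_interval'
        (hwI a ⟨le_rfl, hab⟩ b ⟨hab, le_rfl⟩) (left_mem_uIcc)
      rwa [uIcc_of_le hab] at this
    · intro x hx
      have hp : 0 ≤ ∫ τ in a..x, ‖w τ‖ :=
        intervalIntegral.integral_nonneg hx.1 fun _ _ => norm_nonneg _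
      simpa [abs_of_nonneg hp] using h x ⟨hx.1, hx.2.le⟩
  have := h s hs
  rw [hz s hs, mul_zero] at this
  exact norm_le_zero_iff.1 this

/-- This is the source of the factor `1 / l` gained by an exponential weight, uniformly in the
length of the interval. -/
theorem integral_exp_mul_sub_le {l a s : ℝ} (hl : 0 < l) :
    ∫ τ in a..s, Real.exp (-l * (s - τ)) ≤ 1 / l := by
  have hd : ∀ τ ∈ uIcc a s, HasDerivAt (fun τ => Real.exp (-l * (s - τ)) / l)
      (Real.exp (-l * (s - τ))) τ := by
    intro τ _
    have h1 : HasDerivAt (fun τ : ℝ => -l * (s - τ)) (-l * (0 - 1)) τ :=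
      ((hasDerivAt_const τ s).sub (hasDerivAt_id τ)).const_mul (-l)
    refine (h1.exp.div_const l).congr_deriv ?_
    rw [zero_sub, neg_mul_neg, mul_one, mul_div_assoc, div_self hl.ne', mul_one]
  rw [intervalIntegral.integral_eq_sub_of_hasDerivAt hd
    (Continuous.intervalIntegrable (by fun_prop) _ _)]
  have : 0 ≤ Real.exp (-l * (s - a)) / l := by positivity
  simp only [sub_self, mul_zero, Real.exp_zero]
  linarith

/-- Global solvability of Volterra equations with a Lipschitz kernel. -/
theorem exists_volterra_solution [CompleteSpace X] {a b : ℝ} (hab : a ≤ b) {L : ℝ} (hL : 0 ≤ L)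
    {g : ℝ → X} (hg : Continuous g) {k : ℝ → ℝ → X → X}
    (hk : Continuous fun p : ℝ × ℝ × X => k p.1 p.2.1 p.2.2)
    (hLip : ∀ s ∈ Icc a b, ∀ τ ∈ Icc a s, ∀ x y, ‖k s τ x - k s τ y‖ ≤ L * ‖x - y‖) :
    ∃ f : ℝ → X, Continuous f ∧ ∀ s ∈ Icc a b, f s = g s + ∫ τ in a..s, k s τ (f τ) := by
  -- The unknown is `φ s = exp (-l s) f s`. In this weighted norm the integral operator has
  -- Lipschitz constant at most `L / l ≤ 1/2`, so one contraction covers the whole interval.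
  set l : ℝ := 2 * L + 1 with hl
  have hl0 : 0 < l := by positivity
  have hcont : ∀ φ : C(Icc a b, X), Continuous fun s : ℝ => Real.exp (-l * s) •
      (g s + ∫ τ in a..s, k s τ (Real.exp (l * τ) • φ (projIcc a b hab τ))) := by
    intro φ
    refine Continuous.smul (by fun_prop) (hg.add ?_)
    refine intervalIntegral.continuous_parametric_intervalIntegral_of_continuous
      (f := fun s τ => k s τ (Real.exp (l * τ) • φ (projIcc a b hab τ))) ?_ continuous_id
    exact hk.comp (continuous_fst.prodMk (continuous_snd.prodMk
      (Continuous.smul (by fun_prop)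
        (φ.continuous.comp (continuous_projIcc.comp continuous_snd)))))
  let Ψ : C(Icc a b, X) → C(Icc a b, X) := fun φ =>
    ⟨fun s => Real.exp (-l * s) •
      (g s + ∫ τ in a..s, k s τ (Real.exp (l * τ) • φ (projIcc a b hab τ))),
      (hcont φ).comp continuous_subtype_val⟩
  have hΨ : ContractingWith (1 / 2) Ψ := by
    refine ⟨by rw [← NNReal.coe_lt_coe]; norm_num, LipschitzWith.of_dist_le_mul fun φ ψ => ?_⟩
    rw [ContinuousMap.dist_le (by positivity)]
    rintro ⟨s, hs⟩
    have hki : ∀ φ : C(Icc a b, X), IntervalIntegrable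
        (fun τ => k s τ (Real.exp (l * τ) • φ (projIcc a b hab τ))) volume a s := by
      intro φ
      refine Continuous.intervalIntegrable ?_ _ _
      exact hk.comp (continuous_const.prodMk (continuous_id.prodMk
        (Continuous.smul (by fun_prop) (φ.continuous.comp continuous_projIcc))))
    have e1 : Ψ φ ⟨s, hs⟩ - Ψ ψ ⟨s, hs⟩ = Real.exp (-l * s) • ∫ τ in a..s,
        (k s τ (Real.exp (l * τ) • φ (projIcc a b hab τ))
          - k s τ (Real.exp (l * τ) • ψ (projIcc a b hab τ))) := by
      rw [intervalIntegral.integral_sub (hki φ) (hki ψ)]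
      simp only [Ψ, ContinuousMap.coe_mk]
      rw [← smul_sub]
      congr 1
      abel
    rw [dist_eq_norm, e1, norm_smul, Real.norm_eq_abs, abs_of_pos (Real.exp_pos _)]
    have e2 : ‖∫ τ in a..s, (k s τ (Real.exp (l * τ) • φ (projIcc a b hab τ))
          - k s τ (Real.exp (l * τ) • ψ (projIcc a b hab τ)))‖
        ≤ ∫ τ in a..s, L * (Real.exp (l * τ) * dist φ ψ) := by
      refine intervalIntegral.norm_integral_le_of_norm_le hs.1 ?_
        (Continuous.intervalIntegrable (by fun_prop) _ _)
      refine Eventually.of_forall fun τ hτ => (hLip s hs τ ⟨hτ.1.le, hτ.2⟩ _ _).trans ?_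
      rw [← smul_sub, norm_smul, Real.norm_eq_abs, abs_of_pos (Real.exp_pos _), ← dist_eq_norm]
      gcongr
      exact ContinuousMap.dist_apply_le_dist _
    have e3 : Real.exp (-l * s) * ∫ τ in a..s, L * (Real.exp (l * τ) * dist φ ψ)
        = (L * dist φ ψ) * ∫ τ in a..s, Real.exp (-l * (s - τ)) := by
      rw [← intervalIntegral.integral_const_mul, ← intervalIntegral.integral_const_mul]
      congr 1
      ext τ
      have : Real.exp (-l * (s - τ)) = Real.exp (-l * s) * Real.exp (l * τ) := by
        rw [← Real.exp_add]; ring_nf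
      rw [this]; ring
    calc _ ≤ Real.exp (-l * s) * ∫ τ in a..s, L * (Real.exp (l * τ) * dist φ ψ) := by gcongr
      _ = (L * dist φ ψ) * ∫ τ in a..s, Real.exp (-l * (s - τ)) := e3
      _ ≤ (L * dist φ ψ) * (1 / l) := by gcongr; exact integral_exp_mul_sub_le hl0
      _ ≤ _ := by
        have : L * (1 / l) ≤ 1 / 2 := by rw [mul_one_div, div_le_div_iff₀ hl0 two_pos]; linarith
        calc _ = (L * (1 / l)) * dist φ ψ := by ring
          _ ≤ (1 / 2) * dist φ ψ := by gcongr
          _ = _ := by norm_num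
  set φ := ContractingWith.fixedPoint Ψ hΨ
  have hφ : Ψ φ = φ := hΨ.fixedPoint_isFixedPt
  refine ⟨fun τ => Real.exp (l * τ) • φ (projIcc a b hab τ),
    Continuous.smul (by fun_prop) (φ.continuous.comp continuous_projIcc), fun s hs => ?_⟩
  have h1 : φ ⟨s, hs⟩ = Real.exp (-l * s) •
      (g s + ∫ τ in a..s, k s τ (Real.exp (l * τ) • φ (projIcc a b hab τ))) := by
    conv_lhs => rw [← hφ]
    rfl
  simp only [projIcc_of_mem hab hs]
  rw [h1, smul_smul, ← Real.exp_add]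
  simp

/-- Backward form of `exists_volterra_solution`. -/
theorem exists_volterra_solution_backward [CompleteSpace X] {a b : ℝ} (hab : a ≤ b) {L : ℝ}
    (hL : 0 ≤ L) {g : ℝ → X} (hg : Continuous g) {k : ℝ → ℝ → X → X}
    (hk : Continuous fun p : ℝ × ℝ × X => k p.1 p.2.1 p.2.2)
    (hLip : ∀ t ∈ Icc a b, ∀ τ ∈ Icc t b, ∀ x y, ‖k t τ x - k t τ y‖ ≤ L * ‖x - y‖) :
    ∃ f : ℝ → X, Continuous f ∧ ∀ t ∈ Icc a b, f t = g t + ∫ τ in t..b, k t τ (f τ) := by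
  -- Time reversal `t ↦ -t`.
  obtain ⟨f, hf, hfe⟩ := exists_volterra_solution (neg_le_neg hab) hL
    (g := fun s => g (-s)) (k := fun s τ x => k (-s) (-τ) x) (by fun_prop)
    (hk.comp (g := fun p : ℝ × ℝ × X => k p.1 p.2.1 p.2.2)
      (f := fun p : ℝ × ℝ × X => (-p.1, -p.2.1, p.2.2)) (by fun_prop))
    (fun s hs τ hτ x y => hLip (-s) ⟨by linarith [hs.2], by linarith [hs.1]⟩ (-τ)
      ⟨by linarith [hτ.2], by linarith [hτ.1]⟩ x y)
  refine ⟨fun t => f (-t), by fun_prop, fun t ht => ?_⟩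
  refine (hfe (-t) ⟨by linarith [ht.2], by linarith [ht.1]⟩).trans ?_
  have := intervalIntegral.integral_comp_neg (a := t) (b := b) (fun τ => k t (-τ) (f τ))
  simp only [neg_neg] at this ⊢
  rw [this]

/-- Backward form of `eq_zero_of_norm_le_mul_integral`. -/
theorem eq_zero_of_norm_le_mul_integral_backward {Y : Type*} [NormedAddCommGroup Y] {a b L : ℝ}
    {w : ℝ → Y}
    (hw : ContinuousOn w (Icc a b))
    (h : ∀ t ∈ Icc a b, ‖w t‖ ≤ L * ∫ τ in t..b, ‖w τ‖) : ∀ t ∈ Icc a b, w t = 0 := by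
  intro t ht
  have := eq_zero_of_norm_le_mul_integral (a := -b) (b := -a) (L := L) (w := fun s => w (-s))
    (hw.comp continuous_neg.continuousOn fun s hs => ⟨by linarith [hs.2], by linarith [hs.1]⟩)
    (fun s hs => by
      have h1 := h (-s) ⟨by linarith [hs.2], by linarith [hs.1]⟩
      have h2 := intervalIntegral.integral_comp_neg (a := -b) (b := s) (fun τ => ‖w τ‖)
      rw [neg_neg] at h2
      rwa [h2]) (-t) ⟨by linarith [ht.2], by linarith [ht.1]⟩
  simpa using this

end Volterra

/-! ### Strongly continuous families of operators -/

/-- Freezing the semigroup at negative times turns one-sided continuity into continuity on the line,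
so that integrands such as `E (t - τ) (f τ)` acquire continuous extensions to all `τ`. -/
theorem IsC0Semigroup.continuous_max {H : Type*} [NormedAddCommGroup H] [NormedSpace ℝ H]
    {E : ℝ → H →L[ℝ] H} (hE : IsC0Semigroup E) (x : H) : Continuous fun t => E (max t 0) x :=
  (hE.continuousOn x).comp_continuous (by fun_prop) fun t => le_max_right t 0

section StrongContinuity

variable {H : Type*} [NormedAddCommGroup H] [NormedSpace ℝ H] [CompleteSpace H]

/-- A strongly continuous family of operators is bounded on compact sets. -/
theorem exists_norm_le_of_continuousOn {F : ℝ → H →L[ℝ] H} {s : Set ℝ} (hs : IsCompact s)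
    (hF : ∀ x, ContinuousOn (fun t => F t x) s) : ∃ M, 0 ≤ M ∧ ∀ t ∈ s, ‖F t‖ ≤ M := by
  obtain ⟨C, hC⟩ := banach_steinhaus (g := fun t : s => F t) fun x => by
    obtain ⟨C, hC⟩ := hs.exists_bound_of_continuousOn (hF x)
    exact ⟨C, fun t => hC t t.2⟩
  exact ⟨max C 0, le_max_right _ _, fun t ht => (hC ⟨t, ht⟩).trans (le_max_left _ _)⟩

/-- A strongly continuous family of operators is jointly continuous. -/
theorem continuous_uncurry_of_strong {F : ℝ → H →L[ℝ] H} (hF : ∀ x, Continuous fun t => F t x) :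
    Continuous fun p : ℝ × H => F p.1 p.2 := by
  rw [continuous_iff_continuousAt]
  rintro ⟨t, x⟩
  obtain ⟨M, hM0, hM⟩ := exists_norm_le_of_continuousOn (isCompact_Icc (a := t - 1) (b := t + 1))
    fun x => (hF x).continuousOn
  rw [ContinuousAt, tendsto_iff_norm_sub_tendsto_zero]
  have h1 : Tendsto (fun p : ℝ × H => M * ‖p.2 - x‖ + ‖F p.1 x - F t x‖) (𝓝 (t, x)) (𝓝 0) := by
    have : Continuous fun p : ℝ × H => M * ‖p.2 - x‖ + ‖F p.1 x - F t x‖ := by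
      have := (hF x).comp (continuous_fst (X := ℝ) (Y := H))
      simp only [Function.comp_def] at this
      fun_prop
    simpa using this.tendsto (t, x)
  refine squeeze_zero' (Eventually.of_forall fun _ => norm_nonneg _) ?_ h1
  have h2 : ∀ᶠ p : ℝ × H in 𝓝 (t, x), p.1 ∈ Icc (t - 1) (t + 1) :=
    continuous_fst.continuousAt.eventually (Icc_mem_nhds (by simp) (by simp))
  filter_upwards [h2] with p hp
  calc ‖F p.1 p.2 - F t x‖ = ‖F p.1 (p.2 - x) + (F p.1 x - F t x)‖ := by simp
    _ ≤ ‖F p.1 (p.2 - x)‖ + ‖F p.1 x - F t x‖ := norm_add_le _ _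
    _ ≤ _ := by gcongr; exact (F p.1).le_of_opNorm_le (hM _ hp) _

/-- Extension of a family of operators on `[0,T]` to `ℝ` by constants. -/
theorem continuous_uncurry_projIcc {F : ℝ → H →L[ℝ] H} {T : ℝ} (hT : 0 ≤ T)
    (hF : ∀ x, ContinuousOn (fun t => F t x) (Icc 0 T)) :
    Continuous fun p : ℝ × H => F (projIcc 0 T hT p.1) p.2 :=
  continuous_uncurry_of_strong (F := fun t => F (projIcc 0 T hT t)) fun x =>
    (hF x).comp_continuous (continuous_subtype_val.comp continuous_projIcc) fun t =>
      (projIcc 0 T hT t).2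

end StrongContinuity

/-! ### Strong continuity of the adjoint semigroup -/

section AdjointSemigroup

variable {H : Type*} [NormedAddCommGroup H] [InnerProductSpace ℝ H] [CompleteSpace H]

open ContinuousLinearMap (adjoint)

/-- A semigroup on `[0,∞)`, extended to `ℝ` so that it is jointly continuous together with its
adjoint. -/
structure IsBicontinuousSemigroup (S : ℝ → H →L[ℝ] H) : Prop where
  map_zero : S 0 = ContinuousLinearMap.id ℝ H
  map_add : ∀ s t : ℝ, 0 ≤ s → 0 ≤ t → S (s + t) = (S s).comp (S t)
  continuous : Continuous fun p : ℝ × H => S p.1 p.2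
  continuous_adjoint : Continuous fun p : ℝ × H => adjoint (S p.1) p.2

namespace IsC0Semigroup

variable {E : ℝ → H →L[ℝ] H}

/-- Integrals of a semigroup define bounded operators. -/
theorem exists_integral_operator (hE : IsC0Semigroup E) (h : ℝ) :
    ∃ A : H →L[ℝ] H, ∀ x, A x = ∫ s in (0 : ℝ)..h, E (max s 0) x := by
  obtain ⟨M, hM0, hM⟩ := exists_norm_le_of_continuousOn (F := fun t => E (max t 0))
    (isCompact_uIcc (a := 0) (b := h)) fun x => (hE.continuous_max x).continuousOn
  have hi : ∀ x, IntervalIntegrable (fun s => E (max s 0) x) volume 0 h := fun x =>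
    (hE.continuous_max x).intervalIntegrable _ _
  refine ⟨LinearMap.mkContinuous
    { toFun := fun x => ∫ s in (0 : ℝ)..h, E (max s 0) x
      map_add' := fun x y => by
        simp only [_root_.map_add]
        exact intervalIntegral.integral_add (hi x) (hi y)
      map_smul' := fun c x => by simp } (M * |h - 0|) fun x => ?_, fun x => rfl⟩
  refine (intervalIntegral.norm_integral_le_of_norm_le_const (C := M * ‖x‖) fun s hs => ?_).trans
    (le_of_eq (by ring))
  exact (E (max s 0)).le_of_opNorm_le (hM s (uIoc_subset_uIcc hs)) x

/-- The vectors `y` with this property form a closed subspace `V`. It contains the range of `A*` for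
each averaged operator `A = ∫₀ʰ E` with `0 < h ≤ 1`, because `A (E t) - A` is small in operator norm
and the adjoint is isometric. These ranges are jointly dense, since a vector orthogonal to all of
them is killed by every `A`. -/
theorem adjoint_tendsto_zero (hE : IsC0Semigroup E) (y : H) :
    Tendsto (fun t => adjoint (E (max t 0)) y) (𝓝 0) (𝓝 y) := by
  -- The window reaches `2` because the shifted averages below integrate up to `h + u` with `h, u ≤
  -- 1`.
  obtain ⟨M, hM0, hM⟩ := exists_norm_le_of_continuousOn (F := fun t => E (max t 0))
    (isCompact_Icc (a := -1) (b := 2)) fun x => (hE.continuous_max x).continuousOn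
  let V : Submodule ℝ H :=
    { carrier := {y | Tendsto (fun t => adjoint (E (max t 0)) y) (𝓝 0) (𝓝 y)}
      add_mem' := fun {y z} hy hz => by simpa using Tendsto.add hy hz
      zero_mem' := by simp
      smul_mem' := fun c y hy => by
        simpa using Tendsto.const_smul (M := ℝ) (α := H) hy c }
  have hclosed : closure (V : Set H) ⊆ V := by
    intro y hy
    change Tendsto _ _ _
    rw [Metric.tendsto_nhds]
    intro ε hε
    obtain ⟨y', hy', hd⟩ := Metric.mem_closure_iff.1 hy (ε / (2 * (M + 2))) (by positivity)
    have hy'' : Tendsto (fun t => adjoint (E (max t 0)) y') (𝓝 0) (𝓝 y') := hy'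
    filter_upwards [Metric.tendsto_nhds.1 hy'' (ε / 2) (by positivity),
      Icc_mem_nhds (show (-1 : ℝ) < 0 by norm_num) (show (0 : ℝ) < 2 by norm_num)] with t ht ht2
    rw [dist_eq_norm] at ht hd ⊢
    have h1 : ‖adjoint (E (max t 0)) (y - y')‖ ≤ M * ‖y - y'‖ :=
      ContinuousLinearMap.le_of_opNorm_le _
        ((LinearIsometryEquiv.norm_map adjoint (E (max t 0))).le.trans (hM t ht2)) _
    have h2 : (M + 2) * ‖y - y'‖ < ε / 2 := by
      have := mul_lt_mul_of_pos_left hd (show 0 < M + 2 by positivity)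
      refine this.trans_eq ?_
      field_simp
    calc ‖adjoint (E (max t 0)) y - y‖
        = ‖adjoint (E (max t 0)) (y - y') + (adjoint (E (max t 0)) y' - y') - (y - y')‖ := by
          congr 1; rw [_root_.map_sub]; abel
      _ ≤ ‖adjoint (E (max t 0)) (y - y')‖ + ‖adjoint (E (max t 0)) y' - y'‖ + ‖y - y'‖ :=
          (norm_sub_le _ _).trans (by gcongr; exact norm_add_le _ _)
      _ < ε := by nlinarith [norm_nonneg (y - y')]
  have hmem : ∀ h ∈ Ioc (0 : ℝ) 1, ∀ A : H →L[ℝ] H,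
      (∀ x, A x = ∫ s in (0 : ℝ)..h, E (max s 0) x) → ∀ y, adjoint A y ∈ V := by
    intro h hh A hA y
    change Tendsto _ _ _
    rw [tendsto_iff_norm_sub_tendsto_zero]
    have h1 : Tendsto (fun t : ℝ => 2 * M * |t| * ‖y‖) (𝓝 0) (𝓝 0) := by
      have : Continuous fun t : ℝ => 2 * M * |t| * ‖y‖ := by fun_prop
      simpa using this.tendsto 0
    refine squeeze_zero' (Eventually.of_forall fun _ => norm_nonneg _) ?_ h1
    filter_upwards [Icc_mem_nhds (show (-1 : ℝ) < 0 by norm_num) (show (0 : ℝ) < 1 by norm_num)]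
      with t ht
    -- Composing with `E u` shifts the averaging window by `u`. Only two end pieces of length `u ≤
    -- |t|` survive, each costing `M |t| ‖x‖`.
    have hop : ∀ x, ‖A (E (max t 0) x) - A x‖ ≤ 2 * M * |t| * ‖x‖ := by
      intro x
      set u := max t 0 with hu
      have hu0 : 0 ≤ u := le_max_right _ _
      have hu1 : u ≤ 1 := max_le ht.2 zero_le_one
      have hut : |u| ≤ |t| := by rw [abs_of_nonneg hu0]; exact max_le (le_abs_self t) (abs_nonneg t)
      have e1 : A (E u x) = ∫ s in u..(h + u), E (max s 0) x := by
        have hsh := intervalIntegral.integral_comp_add_right (a := 0) (b := h)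
          (fun s => E (max s 0) x) u
        rw [zero_add] at hsh
        rw [hA, ← hsh]
        refine intervalIntegral.integral_congr fun s hs => ?_
        rw [uIcc_of_le hh.1.le] at hs
        rw [max_eq_left hs.1, max_eq_left (add_nonneg hs.1 hu0), hE.map_add s u hs.1 hu0]
        rfl
      have hi : ∀ a b, IntervalIntegrable (fun s => E (max s 0) x) volume a b := fun a b =>
        (hE.continuous_max x).intervalIntegrable _ _
      have e2 : A (E u x) - A x
          = (∫ s in h..(h + u), E (max s 0) x) - ∫ s in (0 : ℝ)..u, E (max s 0) x := by
        rw [e1, hA, ← intervalIntegral.integral_add_adjacent_intervals (hi u h) (hi h (h + u)),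
          ← intervalIntegral.integral_add_adjacent_intervals (hi 0 u) (hi u h)]
        abel
      have e3 : ‖∫ s in h..(h + u), E (max s 0) x‖ ≤ M * ‖x‖ * |h + u - h| := by
        refine intervalIntegral.norm_integral_le_of_norm_le_const fun s hs => ?_
        rw [uIoc_of_le (by linarith)] at hs
        exact (E (max s 0)).le_of_opNorm_le
          (hM s ⟨by linarith [hs.1, hh.1], by linarith [hs.2, hh.2]⟩) x
      have e4 : ‖∫ s in (0 : ℝ)..u, E (max s 0) x‖ ≤ M * ‖x‖ * |u - 0| := by
        refine intervalIntegral.norm_integral_le_of_norm_le_const fun s hs => ?_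
        rw [uIoc_of_le hu0] at hs
        exact (E (max s 0)).le_of_opNorm_le (hM s ⟨by linarith [hs.1], by linarith [hs.2]⟩) x
      rw [e2]
      have e5 : M * ‖x‖ * |u| ≤ M * ‖x‖ * |t| := by gcongr
      rw [add_sub_cancel_left] at e3
      rw [sub_zero] at e4
      calc _ ≤ _ := norm_sub_le _ _
        _ ≤ M * ‖x‖ * |t| + M * ‖x‖ * |t| := by linarith
        _ = _ := by ring
    have hadj : adjoint (E (max t 0)) (adjoint A y) - adjoint A y
        = adjoint (A ∘L E (max t 0) - A) y := by
      rw [_root_.map_sub, ContinuousLinearMap.adjoint_comp]; rfl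
    rw [hadj]
    refine ContinuousLinearMap.le_of_opNorm_le _ ?_ _
    rw [LinearIsometryEquiv.norm_map]
    exact ContinuousLinearMap.opNorm_le_bound _ (by positivity) hop
  have hperp : Vᗮ = ⊥ := by
    rw [Submodule.eq_bot_iff]
    intro w hw
    -- Testing orthogonality against `A* (A w)` gives `‖A w‖² = 0`. The right derivative of `h ↦ ∫₀ʰ
    -- E s w` at `0` is `w`, which must therefore vanish.
    have hz : ∀ h ∈ Ioc (0 : ℝ) 1, (∫ s in (0 : ℝ)..h, E (max s 0) w) = 0 := by
      intro h hh
      obtain ⟨A, hA⟩ := hE.exists_integral_operator h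
      have := (Submodule.mem_orthogonal V w).1 hw (adjoint A (A w)) (hmem h hh A hA _)
      rw [ContinuousLinearMap.adjoint_inner_left] at this
      rw [← hA]
      exact inner_self_eq_zero.1 this
    have hd : HasDerivWithinAt (fun h => ∫ s in (0 : ℝ)..h, E (max s 0) w) (E (max 0 0) w)
        (Ici 0) 0 :=
      ((hE.continuous_max w).integral_hasStrictDerivAt 0 0).hasDerivAt.hasDerivWithinAt
    have hd' : HasDerivWithinAt (fun h => ∫ s in (0 : ℝ)..h, E (max s 0) w) 0 (Ici 0) 0 := by
      refine (hasDerivWithinAt_const (0 : ℝ) (Ici 0) (0 : H)).congr_of_eventuallyEq ?_ (by simp)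
      filter_upwards [Icc_mem_nhdsGE (show (0 : ℝ) < 1 by norm_num)] with h hh
      rcases hh.1.eq_or_lt with h0 | h0
      · simp [← h0]
      · exact hz h ⟨h0, hh.2⟩
    have := (uniqueDiffWithinAt_Ici (0 : ℝ)).eq_deriv _ hd hd'
    simpa [hE.map_zero] using this
  have htop : V.topologicalClosure = ⊤ := (Submodule.topologicalClosure_eq_top_iff).2 hperp
  have hy : y ∈ V.topologicalClosure := by rw [htop]; trivial
  exact hclosed hy

/-- For `s ≤ u` the semigroup law gives `E(u)* y - E(s)* y = E(s)* (E(u - s)* y - y)`. With a local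
bound on the norms this transfers continuity from time `0` to any time, from both sides at once
because only the smaller time enters the bound. -/
theorem continuous_adjoint_max (hE : IsC0Semigroup E) (y : H) :
    Continuous fun t => adjoint (E (max t 0)) y := by
  rw [continuous_iff_continuousAt]
  intro t
  obtain ⟨M, hM0, hM⟩ := exists_norm_le_of_continuousOn (F := fun t => E (max t 0))
    (isCompact_Icc (a := t - 1) (b := t + 1)) fun x => (hE.continuous_max x).continuousOn
  have hle : ∀ s u, 0 ≤ s → s ≤ u → ‖E s‖ ≤ M →
      ‖adjoint (E u) y - adjoint (E s) y‖ ≤ M * ‖adjoint (E (max (u - s) 0)) y - y‖ := by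
    intro s u hs hsu hMs
    have : adjoint (E u) y - adjoint (E s) y = adjoint (E s) (adjoint (E (max (u - s) 0)) y - y) := by
      rw [max_eq_left (sub_nonneg.2 hsu), _root_.map_sub]
      congr 1
      rw [← ContinuousLinearMap.comp_apply, ← ContinuousLinearMap.adjoint_comp,
        ← hE.map_add _ _ (sub_nonneg.2 hsu) hs, sub_add_cancel]
    rw [this]
    exact ContinuousLinearMap.le_of_opNorm_le _
      ((LinearIsometryEquiv.norm_map adjoint (E s)).le.trans hMs) _
  rw [ContinuousAt, tendsto_iff_norm_sub_tendsto_zero]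
  have hlim : Tendsto (fun u => M * ‖adjoint (E (max |max u 0 - max t 0| 0)) y - y‖) (𝓝 t)
      (𝓝 0) := by
    have h1 : Tendsto (fun u : ℝ => |max u 0 - max t 0|) (𝓝 t) (𝓝 0) := by
      have : Continuous fun u : ℝ => |max u 0 - max t 0| := by fun_prop
      simpa using this.tendsto t
    have h2 := ((hE.adjoint_tendsto_zero y).comp h1).sub_const y
    simpa using h2.norm.const_mul M
  refine squeeze_zero' (Eventually.of_forall fun _ => norm_nonneg _) ?_ hlim
  filter_upwards [Icc_mem_nhds (show t - 1 < t by simp) (show t < t + 1 by simp)] with u hu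
  rcases le_total (max t 0) (max u 0) with h | h
  · rw [abs_of_nonneg (sub_nonneg.2 h)]
    exact hle _ _ (le_max_right _ _) h (hM t (by simp))
  · rw [abs_of_nonpos (sub_nonpos.2 h), neg_sub, norm_sub_rev]
    exact hle _ _ (le_max_right _ _) h (hM u hu)

theorem isBicontinuousSemigroup (hE : IsC0Semigroup E) :
    IsBicontinuousSemigroup fun t => E (max t 0) where
  map_zero := by simpa using hE.map_zero
  map_add s t hs ht := by
    simpa [max_eq_left hs, max_eq_left ht, max_eq_left (add_nonneg hs ht)] using hE.map_add s t hs ht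
  continuous := continuous_uncurry_of_strong hE.continuous_max
  continuous_adjoint := continuous_uncurry_of_strong
    (F := fun t => adjoint (E (max t 0))) hE.continuous_adjoint_max

end IsC0Semigroup

end AdjointSemigroup

theorem continuous_uncurry_apply {H : Type*} [NormedAddCommGroup H]
    [NormedSpace ℝ H] {F : ℝ → H →L[ℝ] H}
    (hF : Continuous fun p : ℝ × H => F p.1 p.2) {Y : Type*} [TopologicalSpace Y] {f : Y → ℝ}
    {g : Y → H} (hf : Continuous f) (hg : Continuous g) : Continuous fun y => F (f y) (g y) :=
  hF.comp (hf.prodMk hg)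

/-! ### Calculus of mild solutions: restarting, product rule, duality -/

section MildCalculus

variable {H : Type*} [NormedAddCommGroup H] [InnerProductSpace ℝ H] [CompleteSpace H]

open ContinuousLinearMap (adjoint)

theorem inner_intervalIntegral_right {f : ℝ → H} {a b : ℝ} (hf : IntervalIntegrable f volume a b)
    (y : H) : ⟪y, ∫ τ in a..b, f τ⟫_ℝ = ∫ τ in a..b, ⟪y, f τ⟫_ℝ :=
  ((innerSL ℝ y).intervalIntegral_comp_comm hf).symm

theorem inner_intervalIntegral_left {f : ℝ → H} {a b : ℝ} (hf : IntervalIntegrable f volume a b)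
    (y : H) : ⟪∫ τ in a..b, f τ, y⟫_ℝ = ∫ τ in a..b, ⟪f τ, y⟫_ℝ := by
  simp_rw [real_inner_comm y]
  exact inner_intervalIntegral_right hf y

namespace IsBicontinuousSemigroup

variable {S : ℝ → H →L[ℝ] H}

theorem cont_apply (hS : IsBicontinuousSemigroup S) {Y : Type*} [TopologicalSpace Y] {f : Y → ℝ}
    {g : Y → H} (hf : Continuous f) (hg : Continuous g) : Continuous fun y => S (f y) (g y) :=
  continuous_uncurry_apply hS.continuous hf hg

theorem cont_adjoint_apply (hS : IsBicontinuousSemigroup S) {Y : Type*} [TopologicalSpace Y]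
    {f : Y → ℝ} {g : Y → H} (hf : Continuous f) (hg : Continuous g) :
    Continuous fun y => adjoint (S (f y)) (g y) :=
  continuous_uncurry_apply (F := fun t => adjoint (S t)) hS.continuous_adjoint hf hg

theorem adjoint_map_add (hS : IsBicontinuousSemigroup S) {s t : ℝ} (hs : 0 ≤ s) (ht : 0 ≤ t)
    (x : H) : adjoint (S (s + t)) x = adjoint (S t) (adjoint (S s) x) := by
  rw [hS.map_add s t hs ht, ContinuousLinearMap.adjoint_comp]; rfl

theorem exists_bound (hS : IsBicontinuousSemigroup S) (T : ℝ) :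
    ∃ M, 0 ≤ M ∧ ∀ t ∈ Icc 0 T, ‖S t‖ ≤ M :=
  exists_norm_le_of_continuousOn isCompact_Icc fun _ =>
    (hS.cont_apply continuous_id continuous_const).continuousOn

/-- Restarting a mild solution of `z' = A z + u` at an intermediate time. -/
theorem mild_restart (hS : IsBicontinuousSemigroup S) {a T : ℝ} {x : H} {u z : ℝ → H}
    (hu : Continuous u)
    (hz : ∀ s ∈ Icc a T, z s = S (s - a) x + ∫ τ in a..s, S (s - τ) (u τ))
    {t τ : ℝ} (ht : t ∈ Icc a T) (hτ : τ ∈ Icc t T) :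
    z τ = S (τ - t) (z t) + ∫ σ in t..τ, S (τ - σ) (u σ) := by
  have hi : ∀ r b c, IntervalIntegrable (fun σ => S (r - σ) (u σ)) volume b c := fun r b c =>
    (hS.cont_apply (by fun_prop) hu).intervalIntegrable _ _
  have h0 : 0 ≤ τ - t := sub_nonneg.2 hτ.1
  rw [hz τ ⟨ht.1.trans hτ.1, hτ.2⟩, hz t ht, _root_.map_add,
    ← ContinuousLinearMap.comp_apply (S (τ - t)), ← hS.map_add _ _ h0 (sub_nonneg.2 ht.1),
    ← ContinuousLinearMap.intervalIntegral_comp_comm _ (hi t a t),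
    ← intervalIntegral.integral_add_adjacent_intervals (hi τ a t) (hi τ t τ), ← add_assoc]
  congr 2
  · congr 2; ring
  · refine intervalIntegral.integral_congr fun σ hσ => ?_
    rw [uIcc_of_le ht.1] at hσ
    rw [← ContinuousLinearMap.comp_apply (S (τ - t)), ← hS.map_add _ _ h0 (sub_nonneg.2 hσ.2)]
    congr 2; ring

/-- Product rule for mild solutions: if `P' + P A + A* P + F = 0` and `z' = A z + u`, then
`(P z)' + A* (P z) + F z - P u = 0`. -/
theorem mild_mul (hS : IsBicontinuousSemigroup S) {a T : ℝ} {x : H} {u z : ℝ → H}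
    {P F : ℝ → H →L[ℝ] H} {PT : H →L[ℝ] H}
    (hF : Continuous fun p : ℝ × H => F p.1 p.2) (hP : Continuous fun p : ℝ × H => P p.1 p.2)
    (hu : Continuous u)
    (hz : ∀ s ∈ Icc a T, z s = S (s - a) x + ∫ τ in a..s, S (s - τ) (u τ))
    (hPe : ∀ x, ∀ t ∈ Icc a T, P t x = adjoint (S (T - t)) (PT (S (T - t) x))
      + ∫ τ in t..T, adjoint (S (τ - t)) (F τ (S (τ - t) x)))
    {t : ℝ} (ht : t ∈ Icc a T) :
    P t (z t) = adjoint (S (T - t)) (PT (z T))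
      + ∫ τ in t..T, adjoint (S (τ - t)) (F τ (z τ) - P τ (u τ)) := by
  have hPu : Continuous fun τ => P τ (u τ) := hP.comp (continuous_id.prodMk hu)
  have hsu : ∀ r, Continuous fun σ => S (r - σ) (u σ) := fun r => hS.cont_apply (by fun_prop) hu
  have hconv : Continuous fun τ => ∫ σ in t..τ, S (τ - σ) (u σ) :=
    intervalIntegral.continuous_parametric_intervalIntegral_of_continuous
      (f := fun τ σ => S (τ - σ) (u σ))
      (hS.cont_apply (by fun_prop) (hu.comp continuous_snd)) continuous_id
  have c1 : Continuous fun τ => adjoint (S (τ - t)) (F τ (S (τ - t) (z t))) :=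
    hS.cont_adjoint_apply (by fun_prop) (continuous_uncurry_apply hF continuous_id (hS.cont_apply (by fun_prop)
      continuous_const))
  have c2 : Continuous fun τ => adjoint (S (τ - t)) (F τ (∫ σ in t..τ, S (τ - σ) (u σ))) :=
    hS.cont_adjoint_apply (by fun_prop) (continuous_uncurry_apply hF continuous_id hconv)
  have c3 : Continuous fun τ => adjoint (S (τ - t)) (P τ (u τ)) :=
    hS.cont_adjoint_apply (by fun_prop) hPu
  have c4 : Continuous (Function.uncurry fun τ σ : ℝ =>
      adjoint (S (τ - t)) (F τ (S (τ - σ) (u σ)))) :=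
    hS.cont_adjoint_apply (by fun_prop) (continuous_uncurry_apply hF continuous_fst (hS.cont_apply (by fun_prop)
      (hu.comp continuous_snd)))
  -- After restarting `z` at time `t`, the terms with `z t` reproduce `P t (z t)`. The terms linear
  -- in `u` are regrouped by Fubini according to the time `σ` at which `u` acts, and must cancel the
  -- integral of `P u`.
  have hzr : ∀ τ ∈ Icc t T, z τ = S (τ - t) (z t) + ∫ σ in t..τ, S (τ - σ) (u σ) :=
    fun τ hτ => hS.mild_restart hu hz ht hτ
  -- the terminal term
  have e1 : adjoint (S (T - t)) (PT (z T)) = adjoint (S (T - t)) (PT (S (T - t) (z t)))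
      + ∫ σ in t..T, adjoint (S (T - t)) (PT (S (T - σ) (u σ))) := by
    rw [hzr T ⟨ht.2, le_rfl⟩, _root_.map_add, _root_.map_add]
    congr 1
    exact ((adjoint (S (T - t)) ∘L PT).intervalIntegral_comp_comm
      ((hsu T).intervalIntegrable _ _)).symm
  -- the running term
  have e2 : ∫ τ in t..T, adjoint (S (τ - t)) (F τ (z τ) - P τ (u τ))
      = (∫ τ in t..T, adjoint (S (τ - t)) (F τ (S (τ - t) (z t))))
        + (∫ σ in t..T, ∫ τ in σ..T, adjoint (S (τ - t)) (F τ (S (τ - σ) (u σ))))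
        - ∫ τ in t..T, adjoint (S (τ - t)) (P τ (u τ)) := by
    rw [← c4.intervalIntegral_triangle_swap ht.2,
      ← intervalIntegral.integral_add (c1.intervalIntegrable _ _),
      ← intervalIntegral.integral_sub _ (c3.intervalIntegrable _ _)]
    · refine intervalIntegral.integral_congr fun τ hτ => ?_
      rw [uIcc_of_le ht.2] at hτ
      rw [_root_.map_sub, hzr τ hτ, _root_.map_add, _root_.map_add]
      congr 2
      exact ((adjoint (S (τ - t)) ∘L F τ).intervalIntegral_comp_comm
        ((hsu τ).intervalIntegrable _ _)).symm
    · refine Continuous.intervalIntegrable (c1.add ?_) _ _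
      exact intervalIntegral.continuous_parametric_intervalIntegral_of_continuous c4 continuous_id
    · refine Continuous.intervalIntegrable ?_ _ _
      exact intervalIntegral.continuous_parametric_intervalIntegral_of_continuous c4 continuous_id
  -- This is the equation of `P` at time `σ`, applied to `u σ` and transported back to `t` by `S(σ -
  -- t)*`.
  have e3 : ∫ τ in t..T, adjoint (S (τ - t)) (P τ (u τ))
      = (∫ σ in t..T, adjoint (S (T - t)) (PT (S (T - σ) (u σ))))
        + ∫ σ in t..T, ∫ τ in σ..T, adjoint (S (τ - t)) (F τ (S (τ - σ) (u σ))) := by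
    rw [← intervalIntegral.integral_add]
    · refine intervalIntegral.integral_congr fun σ hσ => ?_
      rw [uIcc_of_le ht.2] at hσ
      have h0 : 0 ≤ σ - t := sub_nonneg.2 hσ.1
      rw [hPe (u σ) σ ⟨ht.1.trans hσ.1, hσ.2⟩, _root_.map_add]
      congr 1
      · rw [← hS.adjoint_map_add (sub_nonneg.2 hσ.2) h0]
        congr 3; ring
      · rw [← ContinuousLinearMap.intervalIntegral_comp_comm]
        · refine intervalIntegral.integral_congr fun τ hτ => ?_
          rw [uIcc_of_le hσ.2] at hτ
          rw [← hS.adjoint_map_add (sub_nonneg.2 hτ.1) h0]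
          congr 3; ring
        · exact (hS.cont_adjoint_apply (by fun_prop) (continuous_uncurry_apply hF continuous_id
            (hS.cont_apply (by fun_prop) continuous_const))).intervalIntegrable _ _
    · exact ((adjoint (S (T - t)) ∘L PT).continuous.comp (hsu T)).intervalIntegrable _ _
    · refine Continuous.intervalIntegrable ?_ _ _
      exact continuous_intervalIntegral_left (f := fun σ τ =>
        adjoint (S (τ - t)) (F τ (S (τ - σ) (u σ)))) (hS.cont_adjoint_apply (by fun_prop)
          (continuous_uncurry_apply hF continuous_snd (hS.cont_apply (by fun_prop) (hu.comp continuous_fst))))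
        continuous_id T
  rw [e2, e3, e1, hPe (z t) t ht]
  abel

/-- Duality between mild solutions of `z' = A z + u` and `q' + A* q + g = 0`. -/
theorem mild_duality (hS : IsBicontinuousSemigroup S) {a T : ℝ} (haT : a ≤ T) {x qT : H}
    {u z g q : ℝ → H} (hu : Continuous u) (hg : Continuous g)
    (hz : ∀ s ∈ Icc a T, z s = S (s - a) x + ∫ τ in a..s, S (s - τ) (u τ))
    (hq : ∀ t ∈ Icc a T, q t = adjoint (S (T - t)) qT + ∫ τ in t..T, adjoint (S (τ - t)) (g τ)) :
    ⟪q a, x⟫_ℝ = ⟪qT, z T⟫_ℝ + ∫ τ in a..T, (⟪g τ, z τ⟫_ℝ - ⟪q τ, u τ⟫_ℝ) := by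
  have hsu : ∀ r, Continuous fun σ => S (r - σ) (u σ) := fun r => hS.cont_apply (by fun_prop) hu
  have c1 : Continuous fun τ => ⟪g τ, S (τ - a) x⟫_ℝ :=
    hg.inner (hS.cont_apply (by fun_prop) continuous_const)
  have c4 : Continuous (Function.uncurry fun τ σ : ℝ => ⟪g τ, S (τ - σ) (u σ)⟫_ℝ) :=
    (hg.comp continuous_fst).inner (hS.cont_apply (by fun_prop) (hu.comp continuous_snd))
  have c5 : Continuous fun σ => ⟪qT, S (T - σ) (u σ)⟫_ℝ := continuous_const.inner (hsu T)
  have c6 : Continuous fun σ => ∫ τ in σ..T, ⟪g τ, S (τ - σ) (u σ)⟫_ℝ :=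
    continuous_intervalIntegral_left (f := fun σ τ => ⟪g τ, S (τ - σ) (u σ)⟫_ℝ)
      (c4.comp continuous_swap) continuous_id T
  have c7 : Continuous fun τ => ∫ σ in a..τ, ⟪g τ, S (τ - σ) (u σ)⟫_ℝ :=
    intervalIntegral.continuous_parametric_intervalIntegral_of_continuous c4 continuous_id
  have hgi : ∀ r b c, IntervalIntegrable (fun τ => adjoint (S (τ - r)) (g τ)) volume b c :=
    fun r b c => (hS.cont_adjoint_apply (by fun_prop) hg).intervalIntegrable _ _
  have e1 : ⟪qT, z T⟫_ℝ = ⟪qT, S (T - a) x⟫_ℝ + ∫ σ in a..T, ⟪qT, S (T - σ) (u σ)⟫_ℝ := by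
    rw [hz T ⟨haT, le_rfl⟩, inner_add_right,
      inner_intervalIntegral_right ((hsu T).intervalIntegrable _ _)]
  -- With both variation-of-constants formulas inserted, the two double integrals of `⟪g τ, S (τ -
  -- σ) (u σ)⟫` run over the same triangle in opposite orders and cancel.
  have e2 : ∫ τ in a..T, (⟪g τ, z τ⟫_ℝ - ⟪q τ, u τ⟫_ℝ)
      = ∫ τ in a..T, ((⟪g τ, S (τ - a) x⟫_ℝ + ∫ σ in a..τ, ⟪g τ, S (τ - σ) (u σ)⟫_ℝ)
        - (⟪qT, S (T - τ) (u τ)⟫_ℝ + ∫ σ in τ..T, ⟪g σ, S (σ - τ) (u τ)⟫_ℝ)) := by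
    refine intervalIntegral.integral_congr fun τ hτ => ?_
    rw [uIcc_of_le haT] at hτ
    rw [hz τ hτ, hq τ hτ, inner_add_right, inner_add_left,
      inner_intervalIntegral_right ((hsu τ).intervalIntegrable _ _),
      inner_intervalIntegral_left (hgi τ _ _), ContinuousLinearMap.adjoint_inner_left]
    simp_rw [ContinuousLinearMap.adjoint_inner_left]
  have i1 : IntervalIntegrable (fun τ => ⟪g τ, S (τ - a) x⟫_ℝ
      + ∫ σ in a..τ, ⟪g τ, S (τ - σ) (u σ)⟫_ℝ) volume a T := (c1.add c7).intervalIntegrable _ _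
  have i2 : IntervalIntegrable (fun τ => ⟪qT, S (T - τ) (u τ)⟫_ℝ
      + ∫ σ in τ..T, ⟪g σ, S (σ - τ) (u τ)⟫_ℝ) volume a T := (c5.add c6).intervalIntegrable _ _
  rw [e2, intervalIntegral.integral_sub i1 i2, intervalIntegral.integral_add
    (c1.intervalIntegrable _ _) (c7.intervalIntegrable _ _), intervalIntegral.integral_add
    (c5.intervalIntegrable _ _) (c6.intervalIntegrable _ _),
    c4.intervalIntegral_triangle_swap haT, e1, hq a ⟨le_rfl, haT⟩, inner_add_left,
    inner_intervalIntegral_left (hgi a _ _), ContinuousLinearMap.adjoint_inner_left]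
  simp_rw [ContinuousLinearMap.adjoint_inner_left]
  ring

/-- Linear perturbations of the forward equation. -/
theorem exists_mild_forward (hS : IsBicontinuousSemigroup S) {a T : ℝ} (haT : a ≤ T) (x : H)
    {C : ℝ → H →L[ℝ] H} (hC : Continuous fun p : ℝ × H => C p.1 p.2) {w : ℝ → H}
    (hw : Continuous w) : ∃ z : ℝ → H, Continuous z ∧ ∀ s ∈ Icc a T,
      z s = S (s - a) x + ∫ τ in a..s, S (s - τ) (C τ (z τ) + w τ) := by
  obtain ⟨M, hM0, hM⟩ := hS.exists_bound (T - a)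
  obtain ⟨L, hL0, hL⟩ := exists_norm_le_of_continuousOn (F := C) (isCompact_Icc (a := a) (b := T))
    fun y => (continuous_uncurry_apply hC continuous_id continuous_const).continuousOn
  refine exists_volterra_solution haT (L := M * L) (by positivity)
    (k := fun s τ y => S (s - τ) (C τ y + w τ))
    (hS.cont_apply (by fun_prop) continuous_const)
    (hS.cont_apply (by fun_prop) ((continuous_uncurry_apply hC (by fun_prop) (by fun_prop)).add
      (hw.comp (by fun_prop)))) fun s hs τ hτ y y' => ?_
  rw [← _root_.map_sub, add_sub_add_right_eq_sub, ← _root_.map_sub, mul_assoc]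
  exact (S (s - τ)).le_of_opNorm_le_of_le
    (hM _ ⟨sub_nonneg.2 hτ.2, by linarith [hs.2, hτ.1]⟩)
    ((C τ).le_of_opNorm_le (hL τ ⟨hτ.1, hτ.2.trans hs.2⟩) _)

/-- Linear perturbations of the backward equation. -/
theorem exists_mild_backward (hS : IsBicontinuousSemigroup S) {a T : ℝ} (haT : a ≤ T) (x : H)
    {C : ℝ → H →L[ℝ] H} (hC : Continuous fun p : ℝ × H => C p.1 p.2) {w : ℝ → H}
    (hw : Continuous w) : ∃ q : ℝ → H, Continuous q ∧ ∀ t ∈ Icc a T,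
      q t = adjoint (S (T - t)) x + ∫ τ in t..T, adjoint (S (τ - t)) (C τ (q τ) + w τ) := by
  obtain ⟨M, hM0, hM⟩ := hS.exists_bound (T - a)
  obtain ⟨L, hL0, hL⟩ := exists_norm_le_of_continuousOn (F := C) (isCompact_Icc (a := a) (b := T))
    fun y => (continuous_uncurry_apply hC continuous_id continuous_const).continuousOn
  refine exists_volterra_solution_backward haT (L := M * L) (by positivity)
    (k := fun t τ y => adjoint (S (τ - t)) (C τ y + w τ))
    (hS.cont_adjoint_apply (by fun_prop) continuous_const)
    (hS.cont_adjoint_apply (by fun_prop) ((continuous_uncurry_apply hC (by fun_prop)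
      (by fun_prop)).add (hw.comp (by fun_prop)))) fun t ht τ hτ y y' => ?_
  rw [← _root_.map_sub, add_sub_add_right_eq_sub, ← _root_.map_sub, mul_assoc]
  exact (adjoint (S (τ - t))).le_of_opNorm_le_of_le
    ((LinearIsometryEquiv.norm_map adjoint (S (τ - t))).le.trans
      (hM _ ⟨sub_nonneg.2 hτ.1, by linarith [ht.1, hτ.2]⟩))
    ((C τ).le_of_opNorm_le (hL τ ⟨ht.1.trans hτ.1, hτ.2⟩) _)

end IsBicontinuousSemigroup

end MildCalculus

/-! ### Norm cutoffs -/

section NormCutoff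

variable {H : Type*} [NormedAddCommGroup H]

/-- A Lipschitz cutoff function, equal to `1` for `‖y‖ ≤ K` and to `0` for `‖y‖ ≥ 2 K`. -/
noncomputable def normCutoff (K : ℝ) (y : H) : ℝ := max 0 (min 1 (2 - ‖y‖ / K))

theorem normCutoff_nonneg (K : ℝ) (y : H) : 0 ≤ normCutoff K y := le_max_left _ _

theorem normCutoff_le_one (K : ℝ) (y : H) : normCutoff K y ≤ 1 :=
  max_le zero_le_one (min_le_left _ _)

theorem continuous_normCutoff (K : ℝ) : Continuous (normCutoff K : H → ℝ) := by
  unfold normCutoff; fun_prop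

theorem normCutoff_eq_one {K : ℝ} (hK : 0 < K) {y : H} (hy : ‖y‖ ≤ K) : normCutoff K y = 1 := by
  have : ‖y‖ / K ≤ 1 := (div_le_one hK).2 hy
  rw [normCutoff, min_eq_left (by linarith), max_eq_right zero_le_one]

theorem normCutoff_eq_zero {K : ℝ} (hK : 0 < K) {y : H} (hy : 2 * K ≤ ‖y‖) :
    normCutoff K y = 0 := by
  have : 2 ≤ ‖y‖ / K := (le_div_iff₀ hK).2 hy
  rw [normCutoff, max_eq_left ((min_le_right _ _).trans (by linarith))]

theorem abs_normCutoff_sub_le {K : ℝ} (hK : 0 < K) (x y : H) :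
    |normCutoff K x - normCutoff K y| ≤ ‖x - y‖ / K := by
  have h1 : |normCutoff K x - normCutoff K y| ≤ |(2 - ‖x‖ / K) - (2 - ‖y‖ / K)| := by
    unfold normCutoff
    refine (abs_max_sub_max_le_max 0 _ 0 _).trans ?_
    rw [sub_self, abs_zero, max_eq_right (abs_nonneg _)]
    refine (abs_min_sub_min_le_max 1 _ 1 _).trans ?_
    rw [sub_self, abs_zero, max_eq_right (abs_nonneg _)]
  refine h1.trans ?_
  rw [show (2 - ‖x‖ / K) - (2 - ‖y‖ / K) = (‖y‖ - ‖x‖) / K by ring, abs_div, abs_of_pos hK]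
  gcongr
  rw [norm_sub_rev]
  exact abs_norm_sub_norm_le y x

end NormCutoff

/-! ### Truncated quadratic terms and bounds for nonnegative operators -/

section Riccati

variable {H : Type*} [NormedAddCommGroup H] [InnerProductSpace ℝ H]

open ContinuousLinearMap (adjoint)
open InnerProductSpace (rankOne)

/-- The splitting puts the difference of the cutoffs on `x`, which is bounded by `2 K`. What remains
carries the cutoff at `y` and vanishes unless `‖y‖ ≤ 2 K`. Each part contributes `4 K`. -/
theorem norm_cutoff_sub_le_aux {K : ℝ} (hK : 0 < K) {x : H} (hx : ‖x‖ ≤ 2 * K) (y w : H) :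
    ‖(normCutoff K x * ⟪x, w⟫_ℝ) • x - (normCutoff K y * ⟪y, w⟫_ℝ) • y‖
      ≤ 8 * K * ‖w‖ * ‖x - y‖ := by
  have e : (normCutoff K x * ⟪x, w⟫_ℝ) • x - (normCutoff K y * ⟪y, w⟫_ℝ) • y
      = ((normCutoff K x - normCutoff K y) * ⟪x, w⟫_ℝ) • x
        + normCutoff K y • (⟪x - y, w⟫_ℝ • x + ⟪y, w⟫_ℝ • (x - y)) := by
    rw [inner_sub_left]; module
  have h1 : ‖((normCutoff K x - normCutoff K y) * ⟪x, w⟫_ℝ) • x‖ ≤ 4 * K * ‖w‖ * ‖x - y‖ := by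
    rw [norm_smul, norm_mul, Real.norm_eq_abs]
    calc _ ≤ (‖x - y‖ / K) * (‖x‖ * ‖w‖) * ‖x‖ := by
          gcongr
          · exact abs_normCutoff_sub_le hK x y
          · exact norm_inner_le_norm x w
      _ ≤ (‖x - y‖ / K) * ((2 * K) * ‖w‖) * (2 * K) := by gcongr
      _ = _ := by field_simp; ring
  have h2 : ‖normCutoff K y • (⟪x - y, w⟫_ℝ • x + ⟪y, w⟫_ℝ • (x - y))‖
      ≤ 4 * K * ‖w‖ * ‖x - y‖ := by
    rcases le_total (2 * K) ‖y‖ with hy | hy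
    · rw [normCutoff_eq_zero hK hy, zero_smul, norm_zero]; positivity
    · rw [norm_smul, Real.norm_eq_abs, abs_of_nonneg (normCutoff_nonneg K y)]
      calc _ ≤ 1 * (‖x - y‖ * ‖w‖ * ‖x‖ + ‖y‖ * ‖w‖ * ‖x - y‖) := by
            gcongr
            · exact normCutoff_le_one K y
            · refine (norm_add_le _ _).trans ?_
              rw [norm_smul, norm_smul]
              gcongr <;> exact norm_inner_le_norm _ _
        _ ≤ 1 * (‖x - y‖ * ‖w‖ * (2 * K) + (2 * K) * ‖w‖ * ‖x - y‖) := by gcongr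
        _ = _ := by ring
  rw [e]
  refine (norm_add_le _ _).trans ?_
  linarith

/-- The truncated quadratic nonlinearity is Lipschitz. -/
theorem norm_cutoff_sub_le {K : ℝ} (hK : 0 < K) (x y w : H) :
    ‖(normCutoff K x * ⟪x, w⟫_ℝ) • x - (normCutoff K y * ⟪y, w⟫_ℝ) • y‖
      ≤ 8 * K * ‖w‖ * ‖x - y‖ := by
  rcases le_total ‖x‖ (2 * K) with hx | hx
  · exact norm_cutoff_sub_le_aux hK hx y w
  rcases le_total ‖y‖ (2 * K) with hy | hy
  · rw [norm_sub_rev, norm_sub_rev x]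
    exact norm_cutoff_sub_le_aux hK hy x w
  · rw [normCutoff_eq_zero hK hx, normCutoff_eq_zero hK hy]
    simp only [zero_mul, zero_smul, sub_self, norm_zero]
    positivity

/-- A symmetric operator with `0 ≤ P ≤ c` has norm at most `c`. -/
theorem norm_apply_le_of_inner_le {P : H →L[ℝ] H} {c : ℝ} (hc : 0 ≤ c)
    (hsymm : ∀ x y, ⟪P x, y⟫_ℝ = ⟪x, P y⟫_ℝ) (hpos : ∀ x, 0 ≤ ⟪P x, x⟫_ℝ)
    (hle : ∀ x, ⟪P x, x⟫_ℝ ≤ c * ‖x‖ ^ 2) (x : H) : ‖P x‖ ≤ c * ‖x‖ := by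
  -- Polarization: `4 ⟨P x, y⟩ = ⟨P(x+y), x+y⟩ - ⟨P(x-y), x-y⟩`, where the last term may be dropped.
  have key : ∀ y, 4 * ⟪P x, y⟫_ℝ ≤ c * ‖x + y‖ ^ 2 := by
    intro y
    have h1 := hle (x + y)
    have h2 := hpos (x - y)
    simp only [_root_.map_add, _root_.map_sub, inner_add_left, inner_add_right, inner_sub_left,
      inner_sub_right] at h1 h2
    have h3 : ⟪P y, x⟫_ℝ = ⟪P x, y⟫_ℝ := by rw [hsymm, real_inner_comm]
    linarith
  rcases eq_or_ne (P x) 0 with h0 | h0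
  · rw [h0, norm_zero]; positivity
  have hn : 0 < ‖P x‖ := norm_pos_iff.2 h0
  -- The multiple of `P x` with the norm of `x`; this length makes the constant exactly `c`.
  have h1 := key ((‖x‖ / ‖P x‖) • P x)
  rw [inner_smul_right, real_inner_self_eq_norm_sq] at h1
  have h2 : ‖x + (‖x‖ / ‖P x‖) • P x‖ ≤ 2 * ‖x‖ := by
    refine (norm_add_le _ _).trans (le_of_eq ?_)
    rw [norm_smul, Real.norm_eq_abs, abs_of_nonneg (by positivity)]
    field_simp; ring
  have h3 : ‖x + (‖x‖ / ‖P x‖) • P x‖ ^ 2 ≤ (2 * ‖x‖) ^ 2 := by gcongr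
  have h4 : 4 * (‖x‖ / ‖P x‖ * ‖P x‖ ^ 2) = 4 * (‖x‖ * ‖P x‖) := by field_simp
  rw [h4] at h1
  rcases (norm_nonneg x).eq_or_lt with hx | hx
  · rw [norm_eq_zero.1 hx.symm]; simp
  · have h5 : ‖x‖ * ‖P x‖ ≤ ‖x‖ * (c * ‖x‖) := by nlinarith
    exact le_of_mul_le_mul_left h5 hx

theorem continuous_rankOne_self : Continuous fun y : H => rankOne ℝ y y :=
  (ContinuousLinearMap.continuous₂ (rankOne ℝ : H →L[ℝ] H →L⋆[ℝ] H →L[ℝ] H)).comp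
    (continuous_id.prodMk continuous_id)

variable [CompleteSpace H]

/-- `P` is a nonnegative mild solution of `P' + P A + A* P - P N P + Q = 0`, `P(T) = Q`, extended
to a strongly continuous function on `ℝ`. -/
structure IsRiccatiSolution (S : ℝ → H →L[ℝ] H) (T : ℝ) (Q N : H →L[ℝ] H)
    (P : ℝ → H →L[ℝ] H) : Prop where
  isPositive : ∀ t ∈ Icc 0 T, (P t).IsPositive
  continuous : Continuous fun p : ℝ × H => P p.1 p.2
  eq : ∀ x, ∀ t ∈ Icc 0 T, P t x = adjoint (S (T - t)) (Q (S (T - t) x))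
    + ∫ τ in t..T, adjoint (S (τ - t)) ((Q - P τ ∘L N ∘L P τ) (S (τ - t) x))

theorem rankOne_adjoint_apply (A : H →L[ℝ] H) (y x : H) :
    rankOne ℝ (adjoint A y) (adjoint A y) x = adjoint A (rankOne ℝ y y (A x)) := by
  simp [ContinuousLinearMap.adjoint_inner_left]

end Riccati

/-! ### The Riccati equation -/

section RiccatiExistence

variable {H : Type*} [NormedAddCommGroup H] [InnerProductSpace ℝ H] [CompleteSpace H]

open ContinuousLinearMap (adjoint)
open InnerProductSpace (rankOne)

namespace IsBicontinuousSemigroup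

variable {S : ℝ → H →L[ℝ] H}

/-- The bilinear form of a mild solution of `P' + P A + A* P + F = 0`. -/
theorem inner_mild_lyapunov (hS : IsBicontinuousSemigroup S) {T : ℝ} {P F : ℝ → H →L[ℝ] H}
    {PT : H →L[ℝ] H} (hF : Continuous fun p : ℝ × H => F p.1 p.2) {t : ℝ}
    (hPe : ∀ x, P t x = adjoint (S (T - t)) (PT (S (T - t) x))
      + ∫ τ in t..T, adjoint (S (τ - t)) (F τ (S (τ - t) x))) (x y : H) :
    ⟪P t x, y⟫_ℝ = ⟪PT (S (T - t) x), S (T - t) y⟫_ℝ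
      + ∫ τ in t..T, ⟪F τ (S (τ - t) x), S (τ - t) y⟫_ℝ := by
  have hc : Continuous fun τ => adjoint (S (τ - t)) (F τ (S (τ - t) x)) :=
    hS.cont_adjoint_apply (by fun_prop) (continuous_uncurry_apply hF continuous_id
      (hS.cont_apply (by fun_prop) continuous_const))
  rw [hPe, inner_add_left, inner_intervalIntegral_left (hc.intervalIntegrable _ _),
    ContinuousLinearMap.adjoint_inner_left]
  simp_rw [ContinuousLinearMap.adjoint_inner_left]

/-- The equation satisfied by `P v` when `P` solves the Riccati equation with truncated
nonlinearity. -/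
theorem exists_truncated_gain (hS : IsBicontinuousSemigroup S) {T : ℝ} (hT : 0 ≤ T) (q v : H)
    {K : ℝ} (hK : 0 < K) : ∃ f : ℝ → H, Continuous f ∧ ∀ t ∈ Icc 0 T,
      f t = adjoint (S (T - t)) (rankOne ℝ q q (S (T - t) v))
        + ∫ τ in t..T, adjoint (S (τ - t)) (rankOne ℝ q q (S (τ - t) v)
          - (normCutoff K (f τ) * ⟪f τ, S (τ - t) v⟫_ℝ) • f τ) := by
  obtain ⟨M, hM0, hM⟩ := hS.exists_bound T
  have hg : Continuous fun t => adjoint (S (T - t)) (rankOne ℝ q q (S (T - t) v)) :=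
    hS.cont_adjoint_apply (by fun_prop) ((rankOne ℝ q q).continuous.comp
      (hS.cont_apply (by fun_prop) continuous_const))
  have hk : Continuous fun p : ℝ × ℝ × H => adjoint (S (p.2.1 - p.1))
      (rankOne ℝ q q (S (p.2.1 - p.1) v)
        - (normCutoff K p.2.2 * ⟪p.2.2, S (p.2.1 - p.1) v⟫_ℝ) • p.2.2) := by
    have hw : Continuous fun p : ℝ × ℝ × H => S (p.2.1 - p.1) v :=
      hS.cont_apply (by fun_prop) continuous_const
    have hy : Continuous fun p : ℝ × ℝ × H => p.2.2 := by fun_prop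
    refine hS.cont_adjoint_apply (by fun_prop) (((rankOne ℝ q q).continuous.comp hw).sub ?_)
    exact (((continuous_normCutoff K).comp hy).mul (hy.inner hw)).smul hy
  -- One factor `M` bounds the outer adjoint; `8 K` is the Lipschitz constant of the truncated
  -- square, and `M ‖v‖` bounds the vector paired with it.
  refine exists_volterra_solution_backward hT (L := M * (8 * K * (M * ‖v‖)))
    (by positivity) (k := fun t τ y => adjoint (S (τ - t)) (rankOne ℝ q q (S (τ - t) v)
      - (normCutoff K y * ⟪y, S (τ - t) v⟫_ℝ) • y)) hg hk fun t ht τ hτ y y' => ?_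
  have hMt : ‖S (τ - t)‖ ≤ M := hM _ ⟨sub_nonneg.2 hτ.1, by linarith [ht.1, hτ.2]⟩
  rw [← _root_.map_sub, sub_sub_sub_cancel_left, mul_assoc]
  refine (adjoint (S (τ - t))).le_of_opNorm_le_of_le
    ((LinearIsometryEquiv.norm_map adjoint (S (τ - t))).le.trans hMt) ?_
  rw [norm_sub_rev y]
  refine (norm_cutoff_sub_le hK y' y _).trans ?_
  gcongr
  exact (S (τ - t)).le_of_opNorm_le hMt v

/-- Global solvability of the Riccati equation with truncated nonlinearity. -/
theorem exists_truncated_riccati (hS : IsBicontinuousSemigroup S) {T : ℝ} (hT : 0 ≤ T) (q v : H)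
    {K : ℝ} (hK : 0 < K) : ∃ (f : ℝ → H) (P : ℝ → H →L[ℝ] H), Continuous f ∧ Continuous P ∧
      (∀ t ∈ Icc 0 T, P t v = f t) ∧
      ∀ x t, P t x = adjoint (S (T - t)) (rankOne ℝ q q (S (T - t) x))
        + ∫ τ in t..T, adjoint (S (τ - t))
          ((rankOne ℝ q q - normCutoff K (f τ) • rankOne ℝ (f τ) (f τ)) (S (τ - t) x)) := by
  have hcut : Continuous (normCutoff K : H → ℝ) := continuous_normCutoff K
  obtain ⟨f, hf, hfe⟩ := hS.exists_truncated_gain hT q v hK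
  -- Conjugating a rank-one operator by `S` gives the rank-one operator of the vectors `S* q`, `S*
  -- f`. The kernel is therefore norm continuous although `S` is only strongly continuous, and `P`
  -- is defined by an integral of operators.
  obtain ⟨k, hk⟩ : ∃ k : ℝ → ℝ → H →L[ℝ] H, ∀ t τ, k t τ
      = rankOne ℝ (adjoint (S (τ - t)) q) (adjoint (S (τ - t)) q)
        - normCutoff K (f τ) • rankOne ℝ (adjoint (S (τ - t)) (f τ)) (adjoint (S (τ - t)) (f τ)) :=
    ⟨_, fun _ _ => rfl⟩
  have hkc : Continuous (Function.uncurry k) := by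
    have h1 : Continuous fun p : ℝ × ℝ => adjoint (S (p.2 - p.1)) q :=
      hS.cont_adjoint_apply (by fun_prop) continuous_const
    have h2 : Continuous fun p : ℝ × ℝ => adjoint (S (p.2 - p.1)) (f p.2) :=
      hS.cont_adjoint_apply (by fun_prop) (hf.comp continuous_snd)
    have h3 : Continuous fun p : ℝ × ℝ => normCutoff K (f p.2) :=
      hcut.comp (hf.comp continuous_snd)
    refine ((continuous_rankOne_self.comp h1).sub
      (h3.smul (continuous_rankOne_self.comp h2))).congr fun p => ?_
    exact (hk p.1 p.2).symm
  have hkt : ∀ t, Continuous (k t) := fun t => hkc.comp (Continuous.prodMk_right t)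
  have hPe : ∀ x t, (rankOne ℝ (adjoint (S (T - t)) q) (adjoint (S (T - t)) q)
      + ∫ τ in t..T, k t τ) x = adjoint (S (T - t)) (rankOne ℝ q q (S (T - t) x))
        + ∫ τ in t..T, adjoint (S (τ - t))
          ((rankOne ℝ q q - normCutoff K (f τ) • rankOne ℝ (f τ) (f τ)) (S (τ - t) x)) := by
    intro x t
    rw [add_apply, rankOne_adjoint_apply,
      ContinuousLinearMap.intervalIntegral_apply ((hkt t).intervalIntegrable _ _)]
    congr 1
    refine intervalIntegral.integral_congr fun τ _ => ?_
    simp only [hk, sub_apply, smul_apply,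
      rankOne_adjoint_apply, _root_.map_sub, _root_.map_smul]
  refine ⟨f, fun t => rankOne ℝ (adjoint (S (T - t)) q) (adjoint (S (T - t)) q)
    + ∫ τ in t..T, k t τ, hf, ?_, fun t ht => ?_, hPe⟩
  · have h1 : Continuous fun t => adjoint (S (T - t)) q :=
      hS.cont_adjoint_apply (by fun_prop) continuous_const
    exact (continuous_rankOne_self.comp h1).add
      (continuous_intervalIntegral_left hkc continuous_id T)
  · rw [hPe, hfe t ht]
    congr 1
    refine intervalIntegral.integral_congr fun τ _ => ?_
    simp [smul_smul]

/-- The truncated solution solves the true equation as soon as `‖P v‖ ≤ K`. Nonnegativity comes from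
writing `⟨P x, x⟩` as a cost along a closed-loop trajectory, the upper bound from discarding the
nonpositive quadratic term in the integral form. Neither bound depends on `K`, so `K` can be chosen
beforehand. -/
theorem exists_riccati (hS : IsBicontinuousSemigroup S) {T : ℝ} (hT : 0 ≤ T) (q v : H) :
    ∃ P, IsRiccatiSolution S T (rankOne ℝ q q) (rankOne ℝ v v) P := by
  obtain ⟨M, hM0, hM⟩ := hS.exists_bound T
  -- This bounds the cost of the uncontrolled trajectory: `1` for the terminal term and `T` for the
  -- running one. In `K`, the extra `1` only secures positivity.
  set c : ℝ := (M * ‖q‖) ^ 2 * (1 + T) with hc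
  have hc0 : 0 ≤ c := by positivity
  set K : ℝ := c * ‖v‖ + 1 with hKdef
  have hK : 0 < K := by positivity
  obtain ⟨f, P, hf, hP, hPv, hPe⟩ := hS.exists_truncated_riccati hT q v hK
  set F : ℝ → H →L[ℝ] H := fun τ =>
    rankOne ℝ q q - normCutoff K (f τ) • rankOne ℝ (f τ) (f τ) with hFdef
  have hcut : Continuous fun τ => normCutoff K (f τ) := (continuous_normCutoff K).comp hf
  have hFn : Continuous F :=
    continuous_const.sub (hcut.smul (continuous_rankOne_self.comp hf))
  have hF : Continuous fun p : ℝ × H => F p.1 p.2 :=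
    (hFn.comp continuous_fst).clm_apply continuous_snd
  have hPj : Continuous fun p : ℝ × H => P p.1 p.2 :=
    (hP.comp continuous_fst).clm_apply continuous_snd
  have hFi : ∀ τ x y, ⟪F τ x, y⟫_ℝ
      = ⟪q, x⟫_ℝ * ⟪q, y⟫_ℝ - normCutoff K (f τ) * (⟪f τ, x⟫_ℝ * ⟪f τ, y⟫_ℝ) := by
    intro τ x y
    simp [hFdef, inner_sub_left, inner_smul_left]
  have hform : ∀ t x y, ⟪P t x, y⟫_ℝ = ⟪q, S (T - t) x⟫_ℝ * ⟪q, S (T - t) y⟫_ℝ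
      + ∫ τ in t..T, ⟪F τ (S (τ - t) x), S (τ - t) y⟫_ℝ := by
    intro t x y
    rw [hS.inner_mild_lyapunov hF (fun x => hPe x t) x y]
    simp [inner_smul_left]
  have hsymm : ∀ t x y, ⟪P t x, y⟫_ℝ = ⟪x, P t y⟫_ℝ := by
    intro t x y
    rw [← real_inner_comm x, hform, hform]
    simp_rw [hFi]
    congr 1
    · ring
    · congr 1; ext τ; ring
  have hpos : ∀ t ∈ Icc 0 T, ∀ x, 0 ≤ ⟪P t x, x⟫_ℝ := by
    intro t ht x
    have hCc : Continuous fun p : ℝ × H =>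
        (-(normCutoff K (f p.1)) • rankOne ℝ v (f p.1)) p.2 := by
      have h1 : Continuous fun p : ℝ × H => f p.1 := hf.comp continuous_fst
      have h2 : Continuous fun p : ℝ × H => normCutoff K (f p.1) := hcut.comp continuous_fst
      simp only [smul_apply, InnerProductSpace.rankOne_apply]
      exact h2.neg.smul ((h1.inner continuous_snd).smul continuous_const)
    -- The closed loop with truncated feedback, `z' = A z - θ ⟨f, z⟩ v` with `θ = normCutoff K f`,
    -- started from `x` at time `t`.
    obtain ⟨z, hz, hze⟩ := hS.exists_mild_forward ht.2 x
      (C := fun τ => -(normCutoff K (f τ)) • rankOne ℝ v (f τ)) hCc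
      (w := fun _ => 0) continuous_const
    set u : ℝ → H := fun τ => (-(normCutoff K (f τ)) • rankOne ℝ v (f τ)) (z τ) + 0 with hu
    have huc : Continuous u :=
      (hCc.comp (continuous_id.prodMk hz)).add continuous_const
    have hz0 : z t = x := by simpa [hS.map_zero] using hze t ⟨le_rfl, ht.2⟩
    have hmul : ∀ s ∈ Icc t T, P s (z s) = adjoint (S (T - s)) (rankOne ℝ q q (z T))
        + ∫ τ in s..T, adjoint (S (τ - s)) (F τ (z τ) - P τ (u τ)) := fun s hs =>
      hS.mild_mul hF hPj huc hze (fun x s _ => hPe x s) hs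
    have hdual := hS.mild_duality ht.2 huc
      (g := fun τ => F τ (z τ) - P τ (u τ)) (q := fun s => P s (z s))
      ((continuous_uncurry_apply hF continuous_id hz).sub
        (continuous_uncurry_apply hPj continuous_id huc)) hze hmul
    simp only [hz0] at hdual
    rw [hdual]
    -- Since `P v = f`, the integrand is `⟨q,z⟩² - θ⟨f,z⟩² + 2θ⟨f,z⟩² = ⟨q,z⟩² + θ⟨f,z⟩²`: the two
    -- `P u` terms overcompensate the negative one.
    refine add_nonneg ?_ (intervalIntegral.integral_nonneg ht.2 fun τ hτ => ?_)
    · simp [inner_smul_left, mul_self_nonneg]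
    · have hτ' : τ ∈ Icc 0 T := ⟨ht.1.trans hτ.1, hτ.2⟩
      have e1 : ⟪P τ (z τ), u τ⟫_ℝ = -(normCutoff K (f τ) * (⟪f τ, z τ⟫_ℝ * ⟪f τ, z τ⟫_ℝ)) := by
        rw [hsymm]
        have : P τ (u τ) = (-(normCutoff K (f τ)) * ⟪f τ, z τ⟫_ℝ) • f τ := by
          simp [hu, hPv τ hτ', smul_smul]
        rw [this, inner_smul_right, real_inner_comm]
        ring
      have e2 : ⟪P τ (u τ), z τ⟫_ℝ = ⟪P τ (z τ), u τ⟫_ℝ := by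
        rw [hsymm, real_inner_comm]
      rw [inner_sub_left, e2, e1, hFi]
      nlinarith [mul_self_nonneg ⟪q, z τ⟫_ℝ,
        mul_nonneg (normCutoff_nonneg K (f τ)) (mul_self_nonneg ⟪f τ, z τ⟫_ℝ)]
  have hqS : ∀ s ∈ Icc 0 T, ∀ x, ⟪q, S s x⟫_ℝ * ⟪q, S s x⟫_ℝ ≤ (M * ‖q‖) ^ 2 * ‖x‖ ^ 2 := by
    intro s hs x
    have h1 : |⟪q, S s x⟫_ℝ| ≤ ‖q‖ * (M * ‖x‖) :=
      (abs_real_inner_le_norm _ _).trans (by gcongr; exact (S s).le_of_opNorm_le (hM s hs) x)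
    rw [← abs_mul_abs_self]
    calc _ ≤ (‖q‖ * (M * ‖x‖)) * (‖q‖ * (M * ‖x‖)) := by gcongr
      _ = _ := by ring
  have hupper : ∀ t ∈ Icc 0 T, ∀ x, ⟪P t x, x⟫_ℝ ≤ c * ‖x‖ ^ 2 := by
    intro t ht x
    rw [hform]
    have h1 : ∫ τ in t..T, ⟪F τ (S (τ - t) x), S (τ - t) x⟫_ℝ
        ≤ ∫ τ in t..T, (M * ‖q‖) ^ 2 * ‖x‖ ^ 2 := by
      have hSx : Continuous fun τ => S (τ - t) x :=
        hS.cont_apply (by fun_prop) continuous_const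
      refine intervalIntegral.integral_mono_on ht.2
        (((continuous_uncurry_apply hF continuous_id hSx).inner hSx).intervalIntegrable _ _)
        (by simp) fun τ hτ => ?_
      rw [hFi]
      have := hqS (τ - t) ⟨sub_nonneg.2 hτ.1, by linarith [ht.1, hτ.2]⟩ x
      nlinarith [mul_nonneg (normCutoff_nonneg K (f τ)) (mul_self_nonneg ⟪f τ, S (τ - t) x⟫_ℝ)]
    have h2 := hqS (T - t) ⟨sub_nonneg.2 ht.2, by linarith [ht.1]⟩ x
    rw [intervalIntegral.integral_const, smul_eq_mul] at h1
    have h3 : (T - t) * ((M * ‖q‖) ^ 2 * ‖x‖ ^ 2) ≤ T * ((M * ‖q‖) ^ 2 * ‖x‖ ^ 2) := by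
      gcongr; linarith [ht.1]
    calc _ ≤ (M * ‖q‖) ^ 2 * ‖x‖ ^ 2 + T * ((M * ‖q‖) ^ 2 * ‖x‖ ^ 2) := by linarith
      _ = _ := by rw [hc]; ring
  have hone : ∀ t ∈ Icc 0 T, normCutoff K (f t) = 1 := by
    intro t ht
    refine normCutoff_eq_one hK ?_
    rw [← hPv t ht]
    exact (norm_apply_le_of_inner_le hc0 (hsymm t) (hpos t ht) (hupper t ht) v).trans
      (by rw [hKdef]; linarith)
  refine ⟨P, fun t ht => ?_, hPj, fun x t ht => ?_⟩
  · exact (ContinuousLinearMap.isPositive_iff (P t)).2 ⟨fun x y => hsymm t x y, hpos t ht⟩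
  · rw [hPe]
    congr 1
    refine intervalIntegral.integral_congr fun τ hτ => ?_
    rw [uIcc_of_le ht.2] at hτ
    have hτ' : τ ∈ Icc 0 T := ⟨ht.1.trans hτ.1, hτ.2⟩
    rw [hone τ hτ', one_smul]
    simp [← hPv τ hτ', hsymm]

/-- For symmetric `P` the quadratic term only involves `P v`. Applied to `v`, the difference of the
two equations is a linear integral inequality for `P v - P' v`, so Grönwall gives `P v = P' v`; the
equations then agree on every vector. -/
theorem riccati_unique (hS : IsBicontinuousSemigroup S) {T : ℝ} {Q : H →L[ℝ] H} {v : H}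
    {P P' : ℝ → H →L[ℝ] H} (hP : IsRiccatiSolution S T Q (rankOne ℝ v v) P)
    (hP' : IsRiccatiSolution S T Q (rankOne ℝ v v) P') : ∀ t ∈ Icc 0 T, P t = P' t := by
  have hquad : ∀ {P : ℝ → H →L[ℝ] H}, IsRiccatiSolution S T Q (rankOne ℝ v v) P →
      ∀ t ∈ Icc 0 T, ∀ x, P t (rankOne ℝ v v (P t x)) = ⟪P t v, x⟫_ℝ • P t v := by
    intro P hP t ht x
    rw [InnerProductSpace.rankOne_apply, _root_.map_smul,
      (hP.isPositive t ht).inner_left_eq_inner_right]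
  have hcv : ∀ {P : ℝ → H →L[ℝ] H}, IsRiccatiSolution S T Q (rankOne ℝ v v) P →
      Continuous fun t => P t v := fun hP =>
    continuous_uncurry_apply hP.continuous continuous_id continuous_const
  have hint : ∀ {P : ℝ → H →L[ℝ] H}, IsRiccatiSolution S T Q (rankOne ℝ v v) P → ∀ t x,
      Continuous fun τ => adjoint (S (τ - t)) ((Q - P τ ∘L rankOne ℝ v v ∘L P τ) (S (τ - t) x)) := by
    intro P hP t x
    have h1 : Continuous fun τ => S (τ - t) x := hS.cont_apply (by fun_prop) continuous_const
    refine hS.cont_adjoint_apply (by fun_prop) ((Q.continuous.comp h1).sub ?_)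
    exact continuous_uncurry_apply hP.continuous continuous_id ((rankOne ℝ v v).continuous.comp
      (continuous_uncurry_apply hP.continuous continuous_id h1))
  have hdiff : ∀ t ∈ Icc 0 T, ∀ x, P t x - P' t x = ∫ τ in t..T, adjoint (S (τ - t))
      (⟪P' τ v, S (τ - t) x⟫_ℝ • P' τ v - ⟪P τ v, S (τ - t) x⟫_ℝ • P τ v) := by
    intro t ht x
    rw [hP.eq x t ht, hP'.eq x t ht, add_sub_add_left_eq_sub,
      ← intervalIntegral.integral_sub ((hint hP t x).intervalIntegrable _ _)
        ((hint hP' t x).intervalIntegrable _ _)]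
    refine intervalIntegral.integral_congr fun τ hτ => ?_
    rw [uIcc_of_le ht.2] at hτ
    have hτ' : τ ∈ Icc 0 T := ⟨ht.1.trans hτ.1, hτ.2⟩
    rw [← _root_.map_sub]
    congr 1
    rw [sub_apply, sub_apply, sub_sub_sub_cancel_left]
    exact congrArg₂ _ (hquad hP' τ hτ' _) (hquad hP τ hτ' _)
  obtain ⟨M, hM0, hM⟩ := hS.exists_bound T
  obtain ⟨C, hC⟩ := (isCompact_Icc (a := 0) (b := T)).exists_bound_of_continuousOn
    ((hcv hP).continuousOn)
  obtain ⟨C', hC'⟩ := (isCompact_Icc (a := 0) (b := T)).exists_bound_of_continuousOn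
    ((hcv hP').continuousOn)
  have hv : ∀ t ∈ Icc 0 T, P t v - P' t v = 0 := by
    refine eq_zero_of_norm_le_mul_integral_backward (L := M * ((C + C') * (M * ‖v‖)))
      ((hcv hP).sub (hcv hP')).continuousOn fun t ht => ?_
    rw [hdiff t ht, ← intervalIntegral.integral_const_mul]
    refine intervalIntegral.norm_integral_le_of_norm_le ht.2 (Eventually.of_forall fun τ hτ => ?_)
      (Continuous.intervalIntegrable (continuous_const.mul ((hcv hP).sub (hcv hP')).norm) _ _)
    have hτ' : τ ∈ Icc 0 T := ⟨ht.1.trans hτ.1.le, hτ.2⟩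
    have hMt : ‖S (τ - t)‖ ≤ M := hM _ ⟨sub_nonneg.2 hτ.1.le, by linarith [ht.1, hτ.2]⟩
    rw [mul_assoc M]
    refine (adjoint (S (τ - t))).le_of_opNorm_le_of_le
      ((LinearIsometryEquiv.norm_map adjoint (S (τ - t))).le.trans hMt) ?_
    set w := S (τ - t) v
    have hw : ‖w‖ ≤ M * ‖v‖ := (S (τ - t)).le_of_opNorm_le hMt v
    -- Difference of two squares, factored so that `P τ v - P' τ v` appears in each term.
    have e : ⟪P' τ v, w⟫_ℝ • P' τ v - ⟪P τ v, w⟫_ℝ • P τ v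
        = -(⟪P τ v - P' τ v, w⟫_ℝ • P τ v + ⟪P' τ v, w⟫_ℝ • (P τ v - P' τ v)) := by
      rw [inner_sub_left]; module
    rw [e, norm_neg]
    calc _ ≤ ‖P τ v - P' τ v‖ * ‖w‖ * ‖P τ v‖ + ‖P' τ v‖ * ‖w‖ * ‖P τ v - P' τ v‖ := by
          refine (norm_add_le _ _).trans ?_
          rw [norm_smul, norm_smul]
          gcongr <;> exact norm_inner_le_norm _ _
      _ = ((‖P τ v‖ + ‖P' τ v‖) * ‖w‖) * ‖P τ v - P' τ v‖ := by ring
      _ ≤ _ := by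
          have := add_nonneg (norm_nonneg (P τ v)) (norm_nonneg (P' τ v))
          have h2 : ‖P τ v‖ + ‖P' τ v‖ ≤ C + C' := add_le_add (hC τ hτ') (hC' τ hτ')
          gcongr
          exact this.trans h2
  intro t ht
  ext x
  rw [← sub_eq_zero, hdiff t ht]
  refine (intervalIntegral.integral_congr fun τ hτ => ?_).trans intervalIntegral.integral_zero
  rw [uIcc_of_le ht.2] at hτ
  have : P τ v = P' τ v := sub_eq_zero.1 (hv τ ⟨ht.1.trans hτ.1, hτ.2⟩)
  simp [this]

end IsBicontinuousSemigroup

end RiccatiExistence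

/-! ### The coupled forward-backward system -/

section ForwardBackward

variable {H : Type*} [NormedAddCommGroup H] [InnerProductSpace ℝ H] [CompleteSpace H]

open ContinuousLinearMap (adjoint)
open InnerProductSpace (rankOne)

/-- Mild solutions of `z' = (A - N P) z - N r`, `z(0) = z₀`,
`r' + (A* - P N) r + c Q z + ℓ = 0`, `r(T) = c Q z(T) + ℓ`. -/
structure IsCoupledSolution (S : ℝ → H →L[ℝ] H) (T : ℝ) (Q N : H →L[ℝ] H) (c : ℝ) (ℓ z₀ : H)
    (P : ℝ → H →L[ℝ] H) (z r : ℝ → H) : Prop where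
  continuous_z : Continuous z
  continuous_r : Continuous r
  eq_z : ∀ t ∈ Icc 0 T, z t = S (t - 0) z₀ + ∫ τ in (0 : ℝ)..t, S (t - τ) (-N (P τ (z τ) + r τ))
  eq_r : ∀ t ∈ Icc 0 T, r t = adjoint (S (T - t)) (c • Q (z T) + ℓ)
    + ∫ τ in t..T, adjoint (S (τ - t)) (c • Q (z τ) + ℓ - P τ (N (r τ)))

namespace IsRiccatiSolution

variable {S : ℝ → H →L[ℝ] H} {T : ℝ} {Q N : H →L[ℝ] H} {P : ℝ → H →L[ℝ] H}

theorem cont_apply (hP : IsRiccatiSolution S T Q N P) {Y : Type*} [TopologicalSpace Y] {f : Y → ℝ}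
    {g : Y → H} (hf : Continuous f) (hg : Continuous g) : Continuous fun y => P (f y) (g y) :=
  continuous_uncurry_apply hP.continuous hf hg

theorem continuous_source (hP : IsRiccatiSolution S T Q N P) :
    Continuous fun p : ℝ × H => (Q - P p.1 ∘L N ∘L P p.1) p.2 :=
  (Q.continuous.comp continuous_snd).sub (hP.cont_apply continuous_fst (N.continuous.comp
    (hP.cont_apply continuous_fst continuous_snd)))

/-- If `z' = A z - N p`, then `(P z)' + A* (P z) + Q z + P N (p - P z) = 0`. -/
theorem mul_mild (hP : IsRiccatiSolution S T Q N P) (hS : IsBicontinuousSemigroup S) {z₀ : H}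
    {z p : ℝ → H} (hp : Continuous p)
    (hz : ∀ t ∈ Icc 0 T, z t = S (t - 0) z₀ + ∫ τ in (0 : ℝ)..t, S (t - τ) (-N (p τ)))
    {t : ℝ} (ht : t ∈ Icc 0 T) :
    P t (z t) = adjoint (S (T - t)) (Q (z T))
      + ∫ τ in t..T, adjoint (S (τ - t)) (Q (z τ) + P τ (N (p τ - P τ (z τ)))) := by
  rw [hS.mild_mul (F := fun τ => Q - P τ ∘L N ∘L P τ) (u := fun τ => -N (p τ)) hP.continuous_source hP.continuous
    (N.continuous.comp hp).neg hz hP.eq ht]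
  congr 1
  refine intervalIntegral.integral_congr fun τ _ => ?_
  refine congrArg (adjoint (S (τ - t))) ?_
  simp only [sub_apply, ContinuousLinearMap.comp_apply, _root_.map_sub, _root_.map_neg]
  abel

/-- With `p = P z + r` the system becomes `z' = A z - N p`, `p' + A* p + (1 + c) Q z + ℓ = 0`, in
which `P` is absent. The ansatz `p = X z + y` decouples it: `X` solves the Riccati equation with `(1
+ c) Q`, `y` a linear backward equation, then `z` a linear forward one. Finally `r = p - P z`. -/
theorem exists_coupled {q v : H} (hS : IsBicontinuousSemigroup S) (hT : 0 ≤ T)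
    (hP : IsRiccatiSolution S T (rankOne ℝ q q) (rankOne ℝ v v) P) {c : ℝ} (hc : 0 ≤ c)
    (ℓ z₀ : H) :
    ∃ z r, IsCoupledSolution S T (rankOne ℝ q q) (rankOne ℝ v v) c ℓ z₀ P z r := by
  set Q := rankOne ℝ q q with hQ
  set N := rankOne ℝ v v
  -- Rescaling `q` realizes `(1 + c) Q` as a rank-one operator; this requires `1 + c ≥ 0`.
  obtain ⟨X, hX⟩ := hS.exists_riccati hT (√(1 + c) • q) v
  have hQ' : rankOne ℝ (√(1 + c) • q) (√(1 + c) • q) = (1 + c) • Q := by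
    ext x
    simp only [InnerProductSpace.rankOne_apply, smul_apply, hQ, inner_smul_left, smul_smul,
      conj_trivial]
    congr 1
    rw [mul_right_comm, Real.mul_self_sqrt (by positivity)]
  rw [hQ'] at hX
  obtain ⟨y, hy, hye⟩ := hS.exists_mild_backward hT ℓ (C := fun τ => -(X τ ∘L N))
    (hX.cont_apply continuous_fst (N.continuous.comp continuous_snd)).neg
    (w := fun _ => ℓ) continuous_const
  obtain ⟨z, hz, hze⟩ := hS.exists_mild_forward hT z₀ (C := fun τ => -(N ∘L X τ))
    (N.continuous.comp hX.continuous).neg (w := fun τ => -N (y τ)) (N.continuous.comp hy).neg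
  have hXz : Continuous fun τ => X τ (z τ) := hX.cont_apply continuous_id hz
  have hPz : Continuous fun τ => P τ (z τ) := hP.cont_apply continuous_id hz
  have hp : Continuous fun τ => X τ (z τ) + y τ := hXz.add hy
  have hzp : ∀ t ∈ Icc 0 T, z t = S (t - 0) z₀
      + ∫ τ in (0 : ℝ)..t, S (t - τ) (-N (X τ (z τ) + y τ)) := by
    intro t ht
    refine (hze t ht).trans ?_
    congr 2
    ext τ
    congr 1
    simp only [neg_apply, ContinuousLinearMap.comp_apply, _root_.map_add, neg_add]
  refine ⟨z, fun t => X t (z t) + y t - P t (z t), hz, hp.sub hPz, ?_, ?_⟩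
  · intro t ht
    simp only [add_sub_cancel]
    exact hzp t ht
  · intro t ht
    have hNr : Continuous fun τ => P τ (N (X τ (z τ) + y τ - P τ (z τ))) :=
      hP.cont_apply continuous_id (N.continuous.comp (hp.sub hPz))
    have hXy : Continuous fun τ => X τ (N (X τ (z τ) + y τ - X τ (z τ))) :=
      hX.cont_apply continuous_id (N.continuous.comp (hp.sub hXz))
    have hXNy : Continuous fun τ => (-(X τ ∘L N)) (y τ) + ℓ :=
      (hX.cont_apply continuous_id (N.continuous.comp hy)).neg.add continuous_const
    have hQz : Continuous fun τ => Q (z τ) := Q.continuous.comp hz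
    have i1 : IntervalIntegrable (fun τ => adjoint (S (τ - t)) (((1 + c) • Q) (z τ)
        + X τ (N (X τ (z τ) + y τ - X τ (z τ))))) volume t T :=
      (hS.cont_adjoint_apply (by fun_prop)
        ((((1 + c) • Q).continuous.comp hz).add hXy)).intervalIntegrable _ _
    have i2 : IntervalIntegrable (fun τ => adjoint (S (τ - t)) ((-(X τ ∘L N)) (y τ) + ℓ))
        volume t T :=
      (hS.cont_adjoint_apply (by fun_prop) hXNy).intervalIntegrable _ _
    have i3 : IntervalIntegrable (fun τ => adjoint (S (τ - t)) (Q (z τ)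
        + P τ (N (X τ (z τ) + y τ - P τ (z τ))))) volume t T :=
      (hS.cont_adjoint_apply (by fun_prop) (hQz.add hNr)).intervalIntegrable _ _
    rw [hX.mul_mild hS hp hzp ht, hP.mul_mild hS hp hzp ht, hye t ht, add_add_add_comm,
      ← intervalIntegral.integral_add i1 i2, add_sub_add_comm,
      ← intervalIntegral.integral_sub (i1.add i2) i3, ← _root_.map_add, ← _root_.map_sub]
    congr 1
    · congr 1
      simp only [smul_apply]
      module
    · refine intervalIntegral.integral_congr fun τ _ => ?_
      simp only [← _root_.map_add, ← _root_.map_sub]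
      congr 1
      simp only [smul_apply, neg_apply, ContinuousLinearMap.comp_apply, _root_.map_add,
        _root_.map_sub]
      module

/-- The differences `δ` of `z` and `p` of `P z + r` solve the homogeneous Hamiltonian system with
`δ(0) = 0`. Duality gives `0 = (1+c)⟨q,δ(T)⟩² + ∫ ((1+c)⟨q,δ⟩² + ⟨v,p⟩²)`. Hence `⟨v,p⟩ = 0`, so the
forward equation has no source and `δ = 0`, and then `p = 0`. -/
theorem coupled_unique {q v : H} (hS : IsBicontinuousSemigroup S) (hT : 0 ≤ T)
    (hP : IsRiccatiSolution S T (rankOne ℝ q q) (rankOne ℝ v v) P) {c : ℝ} (hc : 0 ≤ c)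
    {ℓ z₀ : H} {z z' r r' : ℝ → H}
    (h : IsCoupledSolution S T (rankOne ℝ q q) (rankOne ℝ v v) c ℓ z₀ P z r)
    (h' : IsCoupledSolution S T (rankOne ℝ q q) (rankOne ℝ v v) c ℓ z₀ P z' r') :
    ∀ t ∈ Icc 0 T, z t = z' t ∧ r t = r' t := by
  set Q := rankOne ℝ q q with hQ
  set N := rankOne ℝ v v with hN
  set δ : ℝ → H := fun t => z t - z' t with hδ
  set ρ : ℝ → H := fun t => r t - r' t with hρ
  have hδc : Continuous δ := h.continuous_z.sub h'.continuous_z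
  have hρc : Continuous ρ := h.continuous_r.sub h'.continuous_r
  set p : ℝ → H := fun t => P t (δ t) + ρ t with hp
  have hpc : Continuous p := (hP.cont_apply continuous_id hδc).add hρc
  have hNp : Continuous fun τ => -N (p τ) := (N.continuous.comp hpc).neg
  have hQδ : Continuous fun τ => Q (δ τ) := Q.continuous.comp hδc
  have hcz : ∀ {z r : ℝ → H}, IsCoupledSolution S T Q N c ℓ z₀ P z r → ∀ t,
      Continuous fun τ => S (t - τ) (-N (P τ (z τ) + r τ)) := fun h t =>
    hS.cont_apply (by fun_prop) (N.continuous.comp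
      ((hP.cont_apply continuous_id h.continuous_z).add h.continuous_r)).neg
  have hcr : ∀ {z r : ℝ → H}, IsCoupledSolution S T Q N c ℓ z₀ P z r → ∀ t,
      Continuous fun τ => adjoint (S (τ - t)) (c • Q (z τ) + ℓ - P τ (N (r τ))) := fun h t =>
    hS.cont_adjoint_apply (by fun_prop) ((((Q.continuous.comp h.continuous_z).const_smul c).add
      continuous_const).sub (hP.cont_apply continuous_id (N.continuous.comp h.continuous_r)))
  have eδ : ∀ t ∈ Icc 0 T, δ t = S (t - 0) 0 + ∫ τ in (0 : ℝ)..t, S (t - τ) (-N (p τ)) := by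
    intro t ht
    simp only [hδ]
    rw [h.eq_z t ht, h'.eq_z t ht, add_sub_add_left_eq_sub, ← intervalIntegral.integral_sub
      ((hcz h t).intervalIntegrable _ _) ((hcz h' t).intervalIntegrable _ _), _root_.map_zero,
      zero_add]
    refine intervalIntegral.integral_congr fun τ _ => ?_
    simp only [← _root_.map_sub]
    congr 1
    simp only [hp, hδ, hρ, _root_.map_add, _root_.map_sub]
    abel
  have eρ : ∀ t ∈ Icc 0 T, ρ t = adjoint (S (T - t)) (c • Q (δ T))
      + ∫ τ in t..T, adjoint (S (τ - t)) (c • Q (δ τ) - P τ (N (ρ τ))) := by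
    intro t ht
    simp only [hρ]
    rw [h.eq_r t ht, h'.eq_r t ht, add_sub_add_comm, ← intervalIntegral.integral_sub
      ((hcr h t).intervalIntegrable _ _) ((hcr h' t).intervalIntegrable _ _), ← _root_.map_sub]
    congr 1
    · congr 1
      simp only [hδ, _root_.map_sub]
      module
    · refine intervalIntegral.integral_congr fun τ _ => ?_
      simp only [← _root_.map_sub]
      congr 1
      simp only [hδ, _root_.map_sub]
      module
  -- The product rule for `P δ` produces `P N ρ`, which cancels the feedback term in the equation of
  -- `ρ`.
  have ep : ∀ t ∈ Icc 0 T, p t = adjoint (S (T - t)) ((1 + c) • Q (δ T))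
      + ∫ τ in t..T, adjoint (S (τ - t)) ((1 + c) • Q (δ τ)) := by
    intro t ht
    have i1 : IntervalIntegrable (fun τ => adjoint (S (τ - t)) (Q (δ τ)
        + P τ (N (p τ - P τ (δ τ))))) volume t T :=
      (hS.cont_adjoint_apply (by fun_prop) (hQδ.add (hP.cont_apply continuous_id
        (N.continuous.comp (hpc.sub (hP.cont_apply continuous_id hδc)))))).intervalIntegrable _ _
    have i2 : IntervalIntegrable (fun τ => adjoint (S (τ - t)) (c • Q (δ τ) - P τ (N (ρ τ))))
        volume t T :=
      (hS.cont_adjoint_apply (by fun_prop) ((hQδ.const_smul c).sub (hP.cont_apply continuous_id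
        (N.continuous.comp hρc)))).intervalIntegrable _ _
    have hpt : p t = P t (δ t) + ρ t := rfl
    rw [hpt, hP.mul_mild hS hpc eδ ht, eρ t ht, add_add_add_comm,
      ← intervalIntegral.integral_add i1 i2, ← _root_.map_add]
    congr 1
    · congr 1; module
    · refine intervalIntegral.integral_congr fun τ _ => ?_
      simp only [← _root_.map_add]
      congr 1
      have : p τ - P τ (δ τ) = ρ τ := by simp [hp]
      rw [this]
      module
  have hdual := hS.mild_duality hT hNp (g := fun τ => (1 + c) • Q (δ τ))
    (hQδ.const_smul (1 + c)) eδ ep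
  have hint : ∀ τ, ⟪(1 + c) • Q (δ τ), δ τ⟫_ℝ - ⟪p τ, -N (p τ)⟫_ℝ
      = (1 + c) * (⟪q, δ τ⟫_ℝ * ⟪q, δ τ⟫_ℝ) + ⟪v, p τ⟫_ℝ * ⟪v, p τ⟫_ℝ := by
    intro τ
    simp only [hQ, hN, InnerProductSpace.rankOne_apply, inner_smul_left, inner_neg_right,
      inner_smul_right, conj_trivial]
    rw [real_inner_comm v (p τ)]
    ring
  have hnn : ∀ τ, 0 ≤ (1 + c) * (⟪q, δ τ⟫_ℝ * ⟪q, δ τ⟫_ℝ) := fun τ =>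
    mul_nonneg (by positivity) (mul_self_nonneg _)
  simp_rw [hint] at hdual
  have hT0 : 0 ≤ ⟪(1 + c) • Q (δ T), δ T⟫_ℝ := by
    have : ⟪(1 + c) • Q (δ T), δ T⟫_ℝ = (1 + c) * (⟪q, δ T⟫_ℝ * ⟪q, δ T⟫_ℝ) := by
      simp [hQ, inner_smul_left]
    rw [this]; exact hnn T
  have hcont : Continuous fun τ => (1 + c) * (⟪q, δ τ⟫_ℝ * ⟪q, δ τ⟫_ℝ)
      + ⟪v, p τ⟫_ℝ * ⟪v, p τ⟫_ℝ := by fun_prop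
  have hvp : ∀ τ ∈ Icc 0 T, ⟪v, p τ⟫_ℝ = 0 := by
    intro τ hτ
    by_contra hne
    have hpos : 0 < ∫ τ in (0 : ℝ)..T, ((1 + c) * (⟪q, δ τ⟫_ℝ * ⟪q, δ τ⟫_ℝ)
        + ⟪v, p τ⟫_ℝ * ⟪v, p τ⟫_ℝ) := by
      -- For `T = 0` the integral carries no information, but then `p 0` is a multiple of `Q (δ 0) =
      -- 0`.
      rcases hT.eq_or_lt with h0 | h0
      · exfalso
        have hτ0 : τ = 0 := le_antisymm (hτ.2.trans h0.symm.le) hτ.1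
        apply hne
        have hδ0 : δ 0 = 0 := by simpa using eδ 0 ⟨le_rfl, hT⟩
        rw [hτ0, ep 0 ⟨le_rfl, hT⟩, ← h0, hδ0]
        simp
      · refine intervalIntegral.integral_pos h0 hcont.continuousOn
          (fun σ _ => add_nonneg (hnn σ) (mul_self_nonneg _)) ⟨τ, hτ, ?_⟩
        exact add_pos_of_nonneg_of_pos (hnn τ) (mul_self_pos.2 hne)
    rw [inner_zero_right] at hdual
    linarith
  have hδ0 : ∀ t ∈ Icc 0 T, δ t = 0 := by
    intro t ht
    rw [eδ t ht, _root_.map_zero, zero_add]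
    refine (intervalIntegral.integral_congr fun τ hτ => ?_).trans intervalIntegral.integral_zero
    rw [uIcc_of_le ht.1] at hτ
    simp [hN, hvp τ ⟨hτ.1, hτ.2.trans ht.2⟩]
  have hp0 : ∀ t ∈ Icc 0 T, p t = 0 := by
    intro t ht
    rw [ep t ht, hδ0 T ⟨hT, le_rfl⟩, _root_.map_zero, smul_zero, _root_.map_zero, zero_add]
    refine (intervalIntegral.integral_congr fun τ hτ => ?_).trans intervalIntegral.integral_zero
    rw [uIcc_of_le ht.2] at hτ
    simp [hδ0 τ ⟨ht.1.trans hτ.1, hτ.2⟩]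
  intro t ht
  have h1 := hδ0 t ht
  have h2 := hp0 t ht
  simp only [hp, h1, _root_.map_zero, zero_add] at h2
  exact ⟨sub_eq_zero.1 h1, sub_eq_zero.1 h2⟩

end IsRiccatiSolution

end ForwardBackward

/-! ### From rank-one data to LQM mild solutions -/

section Transfer

variable {H U K : Type*} [NormedAddCommGroup H] [InnerProductSpace ℝ H] [CompleteSpace H]
  [NormedAddCommGroup U] [InnerProductSpace ℝ U] [CompleteSpace U]
  [NormedAddCommGroup K] [InnerProductSpace ℝ K] [CompleteSpace K]

open ContinuousLinearMap (adjoint)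
open InnerProductSpace (rankOne)

/-- The trace of a rank-one operator. -/
theorem opTrace_rankOne (x y : H) : opTrace (rankOne ℝ x y) = ⟪y, x⟫_ℝ := by
  obtain ⟨b, hb⟩ := (exists_hilbertBasis ℝ H).choose_spec
  rw [opTrace, ← b.tsum_inner_mul_inner y x]
  refine tsum_congr fun e => ?_
  rw [InnerProductSpace.rankOne_apply, inner_smul_right, hb]

theorem projIcc_coe_of_mem {T : ℝ} (hT : 0 ≤ T) {t : ℝ} (ht : t ∈ Icc 0 T) :
    (projIcc 0 T hT t : ℝ) = t := by rw [projIcc_of_mem hT ht]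

namespace IsC0Semigroup

variable {E : ℝ → H →L[ℝ] H} {P : ℝ → H →L[ℝ] H}

/-- Integrability, needed to merge the two integrals, is read off from the frozen semigroup, which
coincides with `E` on the range of integration. -/
theorem integral_riccati_source (hE : IsC0Semigroup E)
    (hP : Continuous fun p : ℝ × H => P p.1 p.2) (Q N : H →L[ℝ] H) {t T : ℝ} (ht : t ≤ T) (x : H) :
    (∫ τ in t..T, adjoint (E (τ - t)) (Q (E (τ - t) x)))
      - (∫ τ in t..T, adjoint (E (τ - t)) (P τ (N (P τ (E (τ - t) x)))))
      = ∫ τ in t..T, adjoint (E (max (τ - t) 0))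
          ((Q - P τ ∘L N ∘L P τ) (E (max (τ - t) 0) x)) := by
  have hS := hE.isBicontinuousSemigroup
  have hSx : Continuous fun τ => E (max (τ - t) 0) x :=
    hS.cont_apply (f := fun τ => τ - t) (by fun_prop) continuous_const
  have i1 : IntervalIntegrable (fun τ => adjoint (E (max (τ - t) 0))
      (Q (E (max (τ - t) 0) x))) volume t T :=
    (hS.cont_adjoint_apply (f := fun τ => τ - t) (by fun_prop)
      (Q.continuous.comp hSx)).intervalIntegrable _ _
  have i2 : IntervalIntegrable (fun τ => adjoint (E (max (τ - t) 0))
      (P τ (N (P τ (E (max (τ - t) 0) x))))) volume t T :=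
    (hS.cont_adjoint_apply (f := fun τ => τ - t) (by fun_prop)
      (continuous_uncurry_apply hP continuous_id (N.continuous.comp
        (continuous_uncurry_apply hP continuous_id hSx)))).intervalIntegrable _ _
  have hmax : ∀ τ ∈ uIcc t T, max (τ - t) 0 = τ - t := fun τ hτ => by
    rw [uIcc_of_le ht] at hτ
    exact max_eq_left (sub_nonneg.2 hτ.1)
  have e1 : ∫ τ in t..T, adjoint (E (τ - t)) (Q (E (τ - t) x))
      = ∫ τ in t..T, adjoint (E (max (τ - t) 0)) (Q (E (max (τ - t) 0) x)) :=
    intervalIntegral.integral_congr fun τ hτ => by simp only [hmax τ hτ]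
  have e2 : ∫ τ in t..T, adjoint (E (τ - t)) (P τ (N (P τ (E (τ - t) x))))
      = ∫ τ in t..T, adjoint (E (max (τ - t) 0)) (P τ (N (P τ (E (max (τ - t) 0) x)))) :=
    intervalIntegral.integral_congr fun τ hτ => by simp only [hmax τ hτ]
  rw [e1, e2, ← intervalIntegral.integral_sub i1 i2]
  refine intervalIntegral.integral_congr fun τ _ => ?_
  rw [← _root_.map_sub]
  rfl

theorem integral_forward_sub (hE : IsC0Semigroup E) {f g : ℝ → H} (hf : Continuous f)
    (hg : Continuous g) {t : ℝ} (ht : 0 ≤ t) (x : H) :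
    x - (∫ τ in (0 : ℝ)..t, E (t - τ) (f τ)) - ∫ τ in (0 : ℝ)..t, E (t - τ) (g τ)
      = x + ∫ τ in (0 : ℝ)..t, E (max (t - τ) 0) (-(f τ + g τ)) := by
  have hS := hE.isBicontinuousSemigroup
  have hi : ∀ {f : ℝ → H}, Continuous f →
      IntervalIntegrable (fun τ => E (max (t - τ) 0) (f τ)) volume 0 t := fun hf =>
    (hS.cont_apply (f := fun τ => t - τ) (by fun_prop) hf).intervalIntegrable _ _
  have e : ∀ f : ℝ → H, ∫ τ in (0 : ℝ)..t, E (t - τ) (f τ)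
      = ∫ τ in (0 : ℝ)..t, E (max (t - τ) 0) (f τ) := fun f =>
    intervalIntegral.integral_congr fun τ hτ => by
      rw [uIcc_of_le ht] at hτ
      simp only [max_eq_left (sub_nonneg.2 hτ.2)]
  rw [e, e, sub_sub, ← intervalIntegral.integral_add (hi hf) (hi hg), sub_eq_add_neg,
    ← intervalIntegral.integral_neg]
  congr 1
  refine intervalIntegral.integral_congr fun τ _ => ?_
  simp only [_root_.map_neg, _root_.map_add]

theorem integral_backward_sub (hE : IsC0Semigroup E) {f g : ℝ → H} (hf : Continuous f)
    (hg : Continuous g) {t T : ℝ} (ht : t ≤ T) (x : H) :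
    x - (∫ τ in t..T, adjoint (E (τ - t)) (f τ)) - ∫ τ in t..T, adjoint (E (τ - t)) (g τ)
      = x + ∫ τ in t..T, adjoint (E (max (τ - t) 0)) (-g τ - f τ) := by
  have hS := hE.isBicontinuousSemigroup
  have hi : ∀ {f : ℝ → H}, Continuous f →
      IntervalIntegrable (fun τ => adjoint (E (max (τ - t) 0)) (f τ)) volume t T := fun hf =>
    (hS.cont_adjoint_apply (f := fun τ => τ - t) (by fun_prop) hf).intervalIntegrable _ _
  have e : ∀ f : ℝ → H, ∫ τ in t..T, adjoint (E (τ - t)) (f τ)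
      = ∫ τ in t..T, adjoint (E (max (τ - t) 0)) (f τ) := fun f =>
    intervalIntegral.integral_congr fun τ hτ => by
      rw [uIcc_of_le ht] at hτ
      simp only [max_eq_left (sub_nonneg.2 hτ.1)]
  rw [e, e, sub_sub, ← intervalIntegral.integral_add (hi hf) (hi hg), sub_eq_add_neg,
    ← intervalIntegral.integral_neg]
  congr 1
  refine intervalIntegral.integral_congr fun τ _ => ?_
  simp only [_root_.map_neg, _root_.map_sub]
  abel

end IsC0Semigroup

namespace LQMData

/-- The coefficients of a game with scalar control, scalar noise and rank-one costs, in which the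
population acts by `S = -c`. -/
structure IsRankOne (D : LQMData H U K) (q v g ℓ : H) (c : ℝ) : Prop where
  BRB_eq : D.BRB = rankOne ℝ v v
  Q_eq : D.Q + D.Qbar = rankOne ℝ q q
  QT_eq : D.QT + D.QbarT = rankOne ℝ q q
  QbarS_eq : ∀ z, D.Qbar (D.S z) = -(c • rankOne ℝ q q z)
  QbarST_eq : ∀ z, D.QbarT (D.ST z) = -(c • rankOne ℝ q q z)
  noise_eq : D.σ ∘L adjoint D.σ = rankOne ℝ g g
  ℓ_eq : D.ℓ = ℓ
  ℓT_eq : D.ℓT = ℓ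
  continuous_c : Continuous D.c

variable {D : LQMData H U K} {q v g ℓ z₀ : H} {c : ℝ} {E : ℝ → H →L[ℝ] H} {T : ℝ}
  {P : ℝ → H →L[ℝ] H} {z r : ℝ → H}

namespace IsRankOne

theorem isMildRiccati (hD : D.IsRankOne q v g ℓ c) (hE : IsC0Semigroup E)
    (hP : IsRiccatiSolution (fun t => E (max t 0)) T (rankOne ℝ q q) (rankOne ℝ v v) P) :
    D.IsMildRiccati E T P where
  isPositive := hP.isPositive
  continuousOn x := (hP.cont_apply continuous_id continuous_const).continuousOn
  eq x t ht := by
    rw [hP.eq x t ht, hD.BRB_eq, hD.Q_eq, hD.QT_eq, max_eq_left (sub_nonneg.2 ht.2), add_sub_assoc,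
      hE.integral_riccati_source hP.continuous _ _ ht.2]

/-- A mild solution is controlled only on `[0,T]`. Extending it by its endpoint values makes it
continuous on the line and leaves the integral equation unchanged. -/
theorem isRiccatiSolution (hD : D.IsRankOne q v g ℓ c) (hE : IsC0Semigroup E)
    (hT : 0 ≤ T) (hP : D.IsMildRiccati E T P) :
    IsRiccatiSolution (fun t => E (max t 0)) T (rankOne ℝ q q) (rankOne ℝ v v)
      (fun t => P (projIcc 0 T hT t)) where
  isPositive t _ := hP.isPositive _ (projIcc 0 T hT t).2
  continuous := continuous_uncurry_projIcc hT hP.continuousOn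
  eq x t ht := by
    rw [← hE.integral_riccati_source (P := fun t => P (projIcc 0 T hT t))
      (continuous_uncurry_projIcc hT hP.continuousOn) _ _ ht.2, projIcc_coe_of_mem hT ht,
      hP.eq x t ht, hD.BRB_eq, hD.Q_eq, hD.QT_eq, max_eq_left (sub_nonneg.2 ht.2), add_sub_assoc]
    congr 2
    refine intervalIntegral.integral_congr fun τ hτ => ?_
    rw [uIcc_of_le ht.2] at hτ
    simp only [projIcc_coe_of_mem hT (t := τ) ⟨ht.1.trans hτ.1, hτ.2⟩]

theorem isMildForwardBackward (hD : D.IsRankOne q v g ℓ c) (hE : IsC0Semigroup E)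
    (hP : IsRiccatiSolution (fun t => E (max t 0)) T (rankOne ℝ q q) (rankOne ℝ v v) P)
    (h : IsCoupledSolution (fun t => E (max t 0)) T (rankOne ℝ q q) (rankOne ℝ v v) c ℓ z₀ P z r) :
    D.IsMildForwardBackward E T z₀ P z r where
  continuousOn_z := h.continuous_z.continuousOn
  continuousOn_r := h.continuous_r.continuousOn
  eq_z t ht := by
    rw [h.eq_z t ht, hD.BRB_eq, hE.integral_forward_sub
      (f := fun τ => rankOne ℝ v v (P τ (z τ))) (g := fun τ => rankOne ℝ v v (r τ))
      ((rankOne ℝ v v).continuous.comp (hP.cont_apply continuous_id h.continuous_z))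
      ((rankOne ℝ v v).continuous.comp h.continuous_r) ht.1, sub_zero, max_eq_left ht.1]
    simp only [_root_.map_add]
  eq_r t ht := by
    have hg : Continuous fun τ => -(c • rankOne ℝ q q (z τ)) - ℓ :=
      (((rankOne ℝ q q).continuous.comp h.continuous_z).const_smul c).neg.sub continuous_const
    rw [h.eq_r t ht]
    simp only [hD.BRB_eq, hD.QbarS_eq, hD.QbarST_eq, hD.ℓ_eq, hD.ℓT_eq, neg_neg]
    rw [hE.integral_backward_sub
      (f := fun τ => P τ (rankOne ℝ v v (r τ))) (hP.cont_apply continuous_id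
        ((rankOne ℝ v v).continuous.comp h.continuous_r)) hg ht.2, max_eq_left (sub_nonneg.2 ht.2)]
    congr 2
    ext τ
    congr 1
    abel

theorem isCoupledSolution (hD : D.IsRankOne q v g ℓ c) (hE : IsC0Semigroup E) (hT : 0 ≤ T)
    (hP : D.IsMildRiccati E T P) (h : D.IsMildForwardBackward E T z₀ P z r) :
    IsCoupledSolution (fun t => E (max t 0)) T (rankOne ℝ q q) (rankOne ℝ v v) c ℓ z₀
      (fun t => P (projIcc 0 T hT t)) (fun t => z (projIcc 0 T hT t))
      (fun t => r (projIcc 0 T hT t)) := by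
  have hpc : Continuous fun t => (projIcc 0 T hT t : ℝ) :=
    continuous_subtype_val.comp continuous_projIcc
  have hz : Continuous fun t => z (projIcc 0 T hT t) :=
    h.continuousOn_z.comp_continuous hpc fun t => (projIcc 0 T hT t).2
  have hr : Continuous fun t => r (projIcc 0 T hT t) :=
    h.continuousOn_r.comp_continuous hpc fun t => (projIcc 0 T hT t).2
  have hPc := continuous_uncurry_projIcc hT hP.continuousOn
  refine ⟨hz, hr, fun t ht => ?_, fun t ht => ?_⟩
  · have e := hE.integral_forward_sub
      (f := fun τ => rankOne ℝ v v (P (projIcc 0 T hT τ) (z (projIcc 0 T hT τ))))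
      (g := fun τ => rankOne ℝ v v (r (projIcc 0 T hT τ)))
      ((rankOne ℝ v v).continuous.comp (continuous_uncurry_apply
        (F := fun τ => P (projIcc 0 T hT τ)) hPc continuous_id hz))
      ((rankOne ℝ v v).continuous.comp hr) ht.1 (E t z₀)
    simp only [_root_.map_add, sub_zero, max_eq_left ht.1]
    rw [← e, projIcc_coe_of_mem hT ht, h.eq_z t ht, hD.BRB_eq]
    have hproj : ∀ τ ∈ uIcc 0 t, (projIcc 0 T hT τ : ℝ) = τ := fun τ hτ => by
      rw [uIcc_of_le ht.1] at hτ
      exact projIcc_coe_of_mem hT ⟨hτ.1, hτ.2.trans ht.2⟩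
    refine congrArg₂ _ (congrArg₂ _ rfl ?_) ?_
    · refine intervalIntegral.integral_congr fun τ hτ => ?_
      simp only [hproj τ hτ]
    · refine intervalIntegral.integral_congr fun τ hτ => ?_
      simp only [hproj τ hτ]
  · have hg : Continuous fun τ => -(c • rankOne ℝ q q (z (projIcc 0 T hT τ))) - ℓ :=
      (((rankOne ℝ q q).continuous.comp hz).const_smul c).neg.sub continuous_const
    have e := hE.integral_backward_sub
      (f := fun τ => P (projIcc 0 T hT τ) (rankOne ℝ v v (r (projIcc 0 T hT τ))))
      (continuous_uncurry_apply (F := fun τ => P (projIcc 0 T hT τ)) hPc continuous_id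
        ((rankOne ℝ v v).continuous.comp hr)) hg ht.2
      (adjoint (E (T - t)) (c • rankOne ℝ q q (z T) + ℓ))
    simp only [neg_sub, sub_neg_eq_add, add_comm ℓ] at e
    simp only [projIcc_coe_of_mem hT ht, projIcc_coe_of_mem hT (right_mem_Icc.2 hT),
      max_eq_left (sub_nonneg.2 ht.2)]
    rw [← e, h.eq_r t ht]
    simp only [hD.BRB_eq, hD.QbarS_eq, hD.QbarST_eq, hD.ℓ_eq, hD.ℓT_eq, neg_neg]
    have hproj : ∀ τ ∈ uIcc t T, (projIcc 0 T hT τ : ℝ) = τ := fun τ hτ => by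
      rw [uIcc_of_le ht.2] at hτ
      exact projIcc_coe_of_mem hT ⟨ht.1.trans hτ.1, hτ.2⟩
    refine congrArg₂ _ (congrArg₂ _ rfl ?_) ?_
    · refine intervalIntegral.integral_congr fun τ hτ => ?_
      simp only [hproj τ hτ]
    · refine intervalIntegral.integral_congr fun τ hτ => ?_
      simp only [hproj τ hτ]

/-- Existence of LQM mild solutions. -/
theorem exists_solution (hD : D.IsRankOne q v g ℓ c) (hc : 0 ≤ c) (hE : IsC0Semigroup E)
    (hT : 0 ≤ T) (z₀ : H) : ∃ P r z s, D.IsLQMMildSolution E T z₀ P r z s := by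
  have hS := hE.isBicontinuousSemigroup
  obtain ⟨P, hP⟩ := hS.exists_riccati hT q v
  obtain ⟨z, r, h⟩ := hP.exists_coupled hS hT hc ℓ z₀
  -- By self-adjointness of `P`, the operator `σ σ* P` is again of rank one, `g ⊗ P g`, so its trace
  -- is explicit and continuous in time.
  have htr : ∀ τ ∈ Icc 0 T, opTrace (D.σ ∘L adjoint D.σ ∘L P τ) = ⟪g, P τ g⟫_ℝ := by
    intro τ hτ
    have : D.σ ∘L adjoint D.σ ∘L P τ = rankOne ℝ g (P τ g) := by
      rw [← ContinuousLinearMap.comp_assoc, hD.noise_eq]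
      ext x
      simp [(hP.isPositive τ hτ).inner_left_eq_inner_right]
    rw [this, opTrace_rankOne, (hP.isPositive τ hτ).inner_left_eq_inner_right]
  have hcont : ContinuousOn (fun τ => 1 / 2 * opTrace (D.σ ∘L adjoint D.σ ∘L P τ)
      - 1 / 2 * ⟪D.BRB (r τ), r τ⟫_ℝ + 1 / 2 * ⟪D.Qbar (D.S (z τ)), D.S (z τ)⟫_ℝ + D.c (z τ))
      (Icc 0 T) := by
    have hPg : Continuous fun τ => P τ g := hP.cont_apply continuous_id continuous_const
    have hz := h.continuous_z
    have hr := h.continuous_r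
    have hcz : Continuous fun τ => D.c (z τ) := hD.continuous_c.comp hz
    have : Continuous fun τ => 1 / 2 * ⟪g, P τ g⟫_ℝ
      - 1 / 2 * ⟪D.BRB (r τ), r τ⟫_ℝ + 1 / 2 * ⟪D.Qbar (D.S (z τ)), D.S (z τ)⟫_ℝ + D.c (z τ) := by
      fun_prop
    refine this.continuousOn.congr fun τ hτ => ?_
    simp only [htr τ hτ]
  refine ⟨P, r, z, _, hD.isMildRiccati hE hP, hD.isMildForwardBackward hE hP h, ?_,
    fun t _ => rfl⟩
  refine continuousOn_const.add ?_
  rw [← uIcc_of_le hT] at hcont ⊢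
  exact intervalIntegral.continuousOn_primitive_interval_left hcont.integrableOn_uIcc

/-- Uniqueness of LQM mild solutions. -/
theorem solution_unique (hD : D.IsRankOne q v g ℓ c) (hc : 0 ≤ c) (hE : IsC0Semigroup E)
    (hT : 0 ≤ T) {P' : ℝ → H →L[ℝ] H} {z' r' : ℝ → H} {s s' : ℝ → ℝ}
    (h : D.IsLQMMildSolution E T z₀ P r z s) (h' : D.IsLQMMildSolution E T z₀ P' r' z' s') :
    ∀ t ∈ Icc 0 T, P t = P' t ∧ r t = r' t ∧ z t = z' t ∧ s t = s' t := by
  have hS := hE.isBicontinuousSemigroup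
  have hR := hD.isRiccatiSolution hE hT h.riccati
  have hPP : ∀ t ∈ Icc 0 T, P t = P' t := by
    intro t ht
    have := hS.riccati_unique hR (hD.isRiccatiSolution hE hT h'.riccati) t ht
    simpa only [projIcc_coe_of_mem hT ht] using this
  -- The extended Riccati solutions agree on the whole line, so both forward-backward pairs belong
  -- to the same system.
  have hPeq : (fun t => P' (projIcc 0 T hT t)) = fun t => P (projIcc 0 T hT t) :=
    funext fun t => (hPP _ (projIcc 0 T hT t).2).symm
  have hC := hD.isCoupledSolution hE hT h.riccati h.forwardBackward
  have hC' := hD.isCoupledSolution hE hT h'.riccati h'.forwardBackward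
  rw [hPeq] at hC'
  have hzr : ∀ t ∈ Icc 0 T, z t = z' t ∧ r t = r' t := by
    intro t ht
    have := hR.coupled_unique hS hT hc hC hC' t ht
    simpa only [projIcc_coe_of_mem hT ht] using this
  intro t ht
  refine ⟨hPP t ht, (hzr t ht).2, (hzr t ht).1, ?_⟩
  rw [h.eq_s t ht, h'.eq_s t ht, (hzr T ⟨hT, le_rfl⟩).1]
  congr 1
  refine intervalIntegral.integral_congr fun τ hτ => ?_
  rw [uIcc_of_le ht.2] at hτ
  have hτ' : τ ∈ Icc 0 T := ⟨ht.1.trans hτ.1, hτ.2⟩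
  simp only [hPP τ hτ', (hzr τ hτ').1, (hzr τ hτ').2]

end IsRankOne

end LQMData

end Transfer

/-! ### The production planning coefficients -/

section ProductionData

open ContinuousLinearMap (adjoint)
open InnerProductSpace (rankOne)

theorem delayProj_eq_rankOne (d : ℝ) : delayProj d = rankOne ℝ
    (WithLp.toLp 2 ((1 : ℝ), (0 : DelayL2 d))) (WithLp.toLp 2 ((1 : ℝ), (0 : DelayL2 d))) := by
  ext1 x
  have h : ⟪WithLp.toLp 2 ((1 : ℝ), (0 : DelayL2 d)), x⟫_ℝ = x.fst := by
    simp [WithLp.prod_inner_apply]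
  have h' : delayProj d x = WithLp.toLp 2 (x.fst, (0 : DelayL2 d)) := rfl
  rw [InnerProductSpace.rankOne_apply, h, h', ← WithLp.toLp_smul]
  simp

theorem toSpanSingleton_comp_adjoint {H : Type*} [NormedAddCommGroup H] [InnerProductSpace ℝ H]
    [CompleteSpace H] (x : H) : ContinuousLinearMap.toSpanSingleton ℝ x ∘L
      adjoint (ContinuousLinearMap.toSpanSingleton ℝ x) = rankOne ℝ x x := by
  rw [ContinuousLinearMap.adjoint_toSpanSingleton]
  rfl

/-- The control cost is absorbed symmetrically: `B R⁻¹ B* = r⁻¹ (1,b) ⊗ (1,b)`, whence `v = r^(-1/2)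
(1,b)`. The population coupling has strength `c = β γ`. -/
theorem isRankOne_productionData (d β γ η : ℝ) {r : ℝ} (hr : 0 < r) (σ : ℝ) (b : DelayL2 d) :
    (productionData d β γ η r σ b).IsRankOne (WithLp.toLp 2 ((1 : ℝ), (0 : DelayL2 d)))
      ((√r)⁻¹ • WithLp.toLp 2 ((1 : ℝ), b)) (WithLp.toLp 2 (σ, (0 : DelayL2 d)))
      (-WithLp.toLp 2 (β * η, (0 : DelayL2 d))) (β * γ) where
  BRB_eq := by
    have hinv : (r • ContinuousLinearMap.id ℝ ℝ).inverse = r⁻¹ • ContinuousLinearMap.id ℝ ℝ := by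
      refine ContinuousLinearMap.inverse_eq ?_ ?_ <;> ext <;> simp [hr.ne']
    simp only [LQMData.BRB, productionData]
    rw [hinv, ContinuousLinearMap.smul_comp, ContinuousLinearMap.id_comp,
      ContinuousLinearMap.comp_smul, toSpanSingleton_comp_adjoint]
    ext1 x
    simp only [smul_apply, InnerProductSpace.rankOne_apply, inner_smul_left, smul_smul,
      conj_trivial]
    congr 1
    rw [mul_right_comm, ← mul_inv, Real.mul_self_sqrt hr.le]
  Q_eq := by simp [productionData, delayProj_eq_rankOne]
  QT_eq := by simp [productionData, delayProj_eq_rankOne]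
  QbarS_eq z := by simp [productionData, delayProj_eq_rankOne, smul_smul]
  QbarST_eq z := by simp [productionData, delayProj_eq_rankOne, smul_smul]
  noise_eq := toSpanSingleton_comp_adjoint _
  ℓ_eq := rfl
  ℓT_eq := rfl
  continuous_c := by
    have : Continuous fun z : DelaySpace d => z.fst := WithLp.continuous_fst 2 ℝ (DelayL2 d)
    simp only [productionData]
    fun_prop

end ProductionData

/-! ### The delay semigroup -/

noncomputable section DelaySemigroup

variable {d : ℝ}

/-- Extension by zero of a function on `[-d,0]`. -/
def zeroExt (x : DelayL2 d) : ℝ → ℝ := (Icc (-d) 0).indicator x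

theorem zeroExt_of_mem (x : DelayL2 d) {ξ : ℝ} (h : ξ ∈ Icc (-d) 0) : zeroExt x ξ = x ξ :=
  indicator_of_mem h _

theorem zeroExt_of_notMem (x : DelayL2 d) {ξ : ℝ} (h : ξ ∉ Icc (-d) 0) : zeroExt x ξ = 0 :=
  indicator_of_notMem h _

theorem memLp_zeroExt (x : DelayL2 d) : MemLp (zeroExt x) 2 volume :=
  (memLp_indicator_iff_restrict measurableSet_Icc).2 (Lp.memLp x)

theorem integrable_zeroExt (x : DelayL2 d) : Integrable (zeroExt x) :=
  (integrable_indicator_iff measurableSet_Icc).2 ((Lp.memLp x).integrable (by norm_num))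

theorem zeroExt_congr {x y : ℝ → ℝ} (h : x =ᵐ[volume.restrict (Icc (-d) 0)] y) :
    (Icc (-d) 0).indicator x =ᵐ[volume] (Icc (-d) 0).indicator y := by
  filter_upwards [(ae_restrict_iff' measurableSet_Icc).1 h] with ξ hξ
  by_cases hm : ξ ∈ Icc (-d) 0
  · rw [indicator_of_mem hm, indicator_of_mem hm, hξ hm]
  · rw [indicator_of_notMem hm, indicator_of_notMem hm]

/-- Extension by zero as a bounded operator. -/
def zeroExtL (d : ℝ) : DelayL2 d →L[ℝ] Lp ℝ 2 (volume : Measure ℝ) :=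
  LinearMap.mkContinuous
    { toFun := fun x => (memLp_zeroExt x).toLp _
      map_add' := fun x y => by
        rw [← MemLp.toLp_add, MemLp.toLp_eq_toLp_iff]
        refine (zeroExt_congr (Lp.coeFn_add x y)).trans (Eventually.of_forall fun ξ => ?_)
        exact congrFun (indicator_add (Icc (-d) 0) (x : ℝ → ℝ) y) ξ
      map_smul' := fun c x => by
        rw [RingHom.id_apply, ← MemLp.toLp_const_smul, MemLp.toLp_eq_toLp_iff]
        refine (zeroExt_congr (Lp.coeFn_smul c x)).trans (Eventually.of_forall fun ξ => ?_)
        exact congrFun (indicator_const_smul (Icc (-d) 0) c (x : ℝ → ℝ)) ξ } 1 fun x => by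
    rw [one_mul]
    change ‖(memLp_zeroExt x).toLp _‖ ≤ _
    rw [Lp.norm_toLp, Lp.norm_def, zeroExt, eLpNorm_indicator_eq_eLpNorm_restrict measurableSet_Icc]

theorem zeroExtL_coeFn (x : DelayL2 d) : zeroExtL d x =ᵐ[volume] zeroExt x :=
  MemLp.coeFn_toLp (memLp_zeroExt x)

theorem measurePreserving_sub_const (t : ℝ) :
    MeasurePreserving (fun ξ : ℝ => ξ - t) volume volume :=
  measurePreserving_sub_right volume t

/-- Translation by `t` to the right on `L²(-d,0)`. -/
def delayShift (d t : ℝ) : DelayL2 d →L[ℝ] DelayL2 d :=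
  LpToLpRestrictCLM ℝ ℝ ℝ volume 2 (Icc (-d) 0) ∘L
    (Lp.compMeasurePreservingₗᵢ ℝ (fun ξ : ℝ => ξ - t)
      (measurePreserving_sub_const t)).toContinuousLinearMap ∘L zeroExtL d

theorem delayShift_coeFn (t : ℝ) (x : DelayL2 d) :
    delayShift d t x =ᵐ[volume.restrict (Icc (-d) 0)] fun ξ => zeroExt x (ξ - t) := by
  have h1 := LpToLpRestrictCLM_coeFn ℝ (Icc (-d) 0)
    (Lp.compMeasurePreserving (fun ξ : ℝ => ξ - t) (measurePreserving_sub_const t) (zeroExtL d x))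
  have h2 := Lp.coeFn_compMeasurePreserving (zeroExtL d x) (measurePreserving_sub_const t)
  have h3 := (measurePreserving_sub_const t).quasiMeasurePreserving.ae_eq_comp (zeroExtL_coeFn x)
  exact h1.trans (ae_restrict_of_ae (h2.trans h3))

theorem continuous_delayShift (x : DelayL2 d) : Continuous fun t => delayShift d t x := by
  have h : Continuous fun t : ℝ => Lp.compMeasurePreserving (fun ξ : ℝ => ξ - t)
      (measurePreserving_sub_const t) (zeroExtL d x) := by
    let g : ℝ → C(ℝ, ℝ) := (ContinuousMap.mk fun p : ℝ × ℝ => p.2 - p.1).curry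
    exact continuous_const.compMeasurePreservingLp (f := fun _ : ℝ => zeroExtL d x) (g := g)
      (ContinuousMap.continuous _) (fun t => measurePreserving_sub_const t) (by norm_num)
  exact (LpToLpRestrictCLM ℝ ℝ ℝ volume 2 (Icc (-d) 0)).continuous.comp h

/-- The extension by zero of a translate. -/
theorem zeroExt_delayShift (t : ℝ) (x : DelayL2 d) :
    zeroExt (delayShift d t x) =ᵐ[volume] (Icc (-d) 0).indicator fun ξ => zeroExt x (ξ - t) :=
  zeroExt_congr (delayShift_coeFn t x)

/-- Right translation pulls points below `-d` from further below, where the extension is already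
zero. Truncation to `[-d,0]` thus loses only what has passed `0`, and this is why truncated
translations compose. -/
theorem indicator_zeroExt_sub {t : ℝ} (ht : 0 ≤ t) (x : DelayL2 d) {ξ : ℝ} (hξ : ξ ≤ 0) :
    (Icc (-d) 0).indicator (fun ξ => zeroExt x (ξ - t)) ξ = zeroExt x (ξ - t) := by
  by_cases h : -d ≤ ξ
  · exact indicator_of_mem (show ξ ∈ Icc (-d) 0 from ⟨h, hξ⟩) _
  · rw [indicator_of_notMem fun h' => h h'.1, zeroExt_of_notMem]
    exact fun h' => h (by linarith [h'.1])

theorem delayShift_zero (x : DelayL2 d) : delayShift d 0 x = x := by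
  refine Lp.ext ((delayShift_coeFn 0 x).trans ?_)
  filter_upwards [ae_restrict_mem measurableSet_Icc] with ξ hξ
  rw [sub_zero, zeroExt_of_mem x hξ]

theorem delayShift_add {s t : ℝ} (hs : 0 ≤ s) (ht : 0 ≤ t) (x : DelayL2 d) :
    delayShift d (s + t) x = delayShift d s (delayShift d t x) := by
  refine Lp.ext ((delayShift_coeFn (s + t) x).trans ((delayShift_coeFn s _).trans ?_).symm)
  have h := (measurePreserving_sub_const s).quasiMeasurePreserving.ae_eq_comp
    (zeroExt_delayShift t x)
  filter_upwards [ae_restrict_mem measurableSet_Icc, ae_restrict_of_ae h] with ξ hξ h1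
  simp only [Function.comp_apply] at h1
  rw [h1, indicator_zeroExt_sub ht x (by linarith [hξ.2]), sub_sub]

/-- Nilpotency. At `t = d` only the single point `ξ = 0` could survive, and it is null. -/
theorem delayShift_eq_zero {t : ℝ} (ht : d ≤ t) (x : DelayL2 d) : delayShift d t x = 0 := by
  refine Lp.ext ((delayShift_coeFn t x).trans (EventuallyEq.trans ?_ (Lp.coeFn_zero _ _ _).symm))
  have h0 : ∀ᵐ ξ : ℝ, ξ ≠ 0 := by simp [ae_iff]
  filter_upwards [ae_restrict_mem measurableSet_Icc, ae_restrict_of_ae h0] with ξ hξ hne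
  rw [zeroExt_of_notMem]
  · rfl
  · intro h
    exact hne (le_antisymm hξ.2 (by linarith [h.1]))

/-- The functional `x ↦ ∫_{-t}^0 x` on `L²(-d,0)`. -/
def delayMass (d t : ℝ) : DelayL2 d →L[ℝ] ℝ :=
  innerSL ℝ (indicatorConstLp 2 (μ := volume.restrict (Icc (-d) 0)) (s := Ioc (-t) 0)
    measurableSet_Ioc (measure_ne_top _ _) (1 : ℝ))

theorem delayMass_apply {t : ℝ} (ht : 0 ≤ t) (x : DelayL2 d) :
    delayMass d t x = ∫ ξ in (-t)..0, zeroExt x ξ := by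
  rw [delayMass, innerSL_apply_apply, L2.inner_indicatorConstLp_one,
    intervalIntegral.integral_of_le (by linarith), zeroExt, setIntegral_indicator measurableSet_Icc,
    Measure.restrict_restrict measurableSet_Ioc]

/-- The semigroup `e^{tA} (x₀, x₁) = (x₀ + ∫_{-t}^0 x₁, x₁(· - t))`. -/
def delaySemigroup (d t : ℝ) : DelaySpace d →L[ℝ] DelaySpace d :=
  (WithLp.prodContinuousLinearEquiv 2 ℝ ℝ (DelayL2 d)).symm.toContinuousLinearMap ∘L
    ((ContinuousLinearMap.fst ℝ ℝ (DelayL2 d)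
        + delayMass d t ∘L ContinuousLinearMap.snd ℝ ℝ (DelayL2 d)).prod
      (delayShift d t ∘L ContinuousLinearMap.snd ℝ ℝ (DelayL2 d))) ∘L
      (WithLp.prodContinuousLinearEquiv 2 ℝ ℝ (DelayL2 d)).toContinuousLinearMap

theorem delaySemigroup_apply (t : ℝ) (x : DelaySpace d) : delaySemigroup d t x
    = WithLp.toLp 2 (x.fst + delayMass d t x.snd, delayShift d t x.snd) := rfl

theorem intervalIntegrable_zeroExt (x : DelayL2 d) (a b : ℝ) :
    IntervalIntegrable (zeroExt x) volume a b :=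
  (integrable_zeroExt x).intervalIntegrable

/-- The mass leaving at `0` up to time `s + t` is what leaves up to `t` plus what the translate
loses during the next `s`. -/
theorem delayMass_add {s t : ℝ} (hs : 0 ≤ s) (ht : 0 ≤ t) (x : DelayL2 d) :
    delayMass d (s + t) x = delayMass d t x + delayMass d s (delayShift d t x) := by
  have h1 : ∫ ξ in (-s)..0, zeroExt (delayShift d t x) ξ = ∫ ξ in (-s)..0, zeroExt x (ξ - t) := by
    refine intervalIntegral.integral_congr_ae ?_
    filter_upwards [zeroExt_delayShift t x] with ξ hξ hmem
    rw [uIoc_of_le (by linarith)] at hmem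
    rw [hξ, indicator_zeroExt_sub ht x hmem.2]
  rw [delayMass_apply (add_nonneg hs ht), delayMass_apply ht, delayMass_apply hs, h1,
    intervalIntegral.integral_comp_sub_right, add_comm (∫ ξ in (-t)..0, zeroExt x ξ), zero_sub,
    intervalIntegral.integral_add_adjacent_intervals (intervalIntegrable_zeroExt x _ _)
      (intervalIntegrable_zeroExt x _ _)]
  congr 1
  ring

theorem isC0Semigroup_delaySemigroup (d : ℝ) : IsC0Semigroup (delaySemigroup d) where
  map_zero := by
    ext1 x
    rw [delaySemigroup_apply, delayShift_zero, delayMass_apply le_rfl]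
    simp
    rfl
  map_add s t hs ht := by
    ext1 x
    rw [ContinuousLinearMap.comp_apply, delaySemigroup_apply, delaySemigroup_apply,
      delaySemigroup_apply, delayShift_add hs ht, delayMass_add hs ht, ← add_assoc]
    rfl
  continuousOn x := by
    have h1 : ContinuousOn (fun t => delayMass d t x.snd) (Ici 0) := by
      have : Continuous fun t => ∫ ξ in (-t)..0, zeroExt x.snd ξ := by
        simp_rw [intervalIntegral.integral_symm 0]
        exact ((intervalIntegral.continuous_primitive
          (intervalIntegrable_zeroExt x.snd) 0).comp continuous_neg).neg
      exact this.continuousOn.congr fun t ht => delayMass_apply ht _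
    exact (WithLp.prodContinuousLinearEquiv 2 ℝ ℝ (DelayL2 d)).symm.continuous.comp_continuousOn
      ((continuousOn_const.add h1).prodMk (continuous_delayShift x.snd).continuousOn)

end DelaySemigroup

/-! ### The du Bois-Reymond lemma -/

section DuBoisReymond

/-- A continuous function whose weak derivative vanishes is constant. -/
theorem eqOn_const_of_integral_mul_deriv_eq_zero {a b : ℝ} (hab : a < b) {w : ℝ → ℝ}
    (hw : ContinuousOn w (Icc a b))
    (h : ∀ φ : ℝ → ℝ, ContDiff ℝ ∞ φ → tsupport φ ⊆ Ioo a b →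
      ∫ ξ in Icc a b, w ξ * deriv φ ξ = 0) : ∀ ξ ∈ Icc a b, w ξ = w a := by
  let bump : ContDiffBump ((a + b) / 2) :=
    { rIn := (b - a) / 8
      rOut := (b - a) / 4
      rIn_pos := by linarith
      rIn_lt_rOut := by linarith }
  set ρ : ℝ → ℝ := bump.normed volume with hρ
  have hρs : ContDiff ℝ ∞ ρ := bump.contDiff_normed
  have hρi : ∫ ξ, ρ ξ = 1 := bump.integral_normed
  have hρt : tsupport ρ = Metric.closedBall ((a + b) / 2) ((b - a) / 4) := bump.tsupport_normed_eq
  have hρsub : tsupport ρ ⊆ Ioo a b := by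
    rw [hρt, Real.closedBall_eq_Icc]
    exact fun ξ hξ => ⟨by linarith [hξ.1], by linarith [hξ.2]⟩
  have hρc : HasCompactSupport ρ := bump.hasCompactSupport_normed
  have hρne : (tsupport ρ).Nonempty := by
    rw [hρt]; exact Metric.nonempty_closedBall.2 (by linarith)
  have hzero : ∀ {f : ℝ → ℝ}, tsupport f ⊆ Ioo a b → ∀ ξ, ξ ∉ Icc a b → f ξ = 0 := by
    intro f hf ξ hξ
    by_contra hne
    exact hξ (Ioo_subset_Icc_self (hf (subset_tsupport f hne)))
  have hwi : ∀ {f : ℝ → ℝ}, Continuous f → IntegrableOn (fun ξ => w ξ * f ξ) (Icc a b) :=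
    fun hf => (hw.mul hf.continuousOn).integrableOn_Icc
  set c := ∫ ξ in Icc a b, w ξ * ρ ξ with hc
  have hae : ∀ᵐ ξ, ξ ∈ Ioo a b → w ξ - c = 0 := by
    refine isOpen_Ioo.ae_eq_zero_of_integral_contDiff_smul_eq_zero ?_ fun ψ hψ hψc hψt => ?_
    · exact (((hw.sub continuousOn_const).integrableOn_Icc (μ := volume)).mono_set
        Ioo_subset_Icc_self).locallyIntegrableOn
    set m := ∫ ξ, ψ ξ with hm
    -- Removing the mean of `ψ` by the unit-mass bump `ρ` gives a function whose primitive is a test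
    -- function. Hence `∫ w ψ = c ∫ ψ` with `c = ∫ w ρ`.
    set g : ℝ → ℝ := fun ξ => ψ ξ - m * ρ ξ with hg
    have hgs : ContDiff ℝ ∞ g := hψ.sub (contDiff_const.mul hρs)
    have hψi : Integrable ψ := hψ.continuous.integrable_of_hasCompactSupport hψc
    have hρi' : Integrable ρ := hρs.continuous.integrable_of_hasCompactSupport hρc
    have hgi : ∫ ξ, g ξ = 0 := by
      rw [hg, integral_sub hψi (hρi'.const_mul m), integral_const_mul, hρi, hm]
      ring
    set K := tsupport ψ ∪ tsupport ρ with hK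
    have hKc : IsCompact K := hψc.isCompact.union hρc.isCompact
    have hKne : K.Nonempty := hρne.inr
    have hKs : K ⊆ Ioo a b := union_subset hψt hρsub
    obtain ⟨a', ha'K, ha'⟩ := hKc.exists_isLeast hKne
    obtain ⟨b', hb'K, hb'⟩ := hKc.exists_isGreatest hKne
    have hg0 : ∀ ξ, ξ ∉ K → g ξ = 0 := by
      intro ξ hξ
      have h1 : ψ ξ = 0 := image_eq_zero_of_notMem_tsupport fun h => hξ (Or.inl h)
      have h2 : ρ ξ = 0 := image_eq_zero_of_notMem_tsupport fun h => hξ (Or.inr h)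
      simp [hg, h1, h2]
    set φ : ℝ → ℝ := fun ξ => ∫ η in a..ξ, g η with hφ
    have hd : ∀ ξ, HasDerivAt φ (g ξ) ξ := fun ξ =>
      (hgs.continuous.integral_hasStrictDerivAt a ξ).hasDerivAt
    have hderiv : deriv φ = g := funext fun ξ => (hd ξ).deriv
    have hφs : ContDiff ℝ ∞ φ :=
      contDiff_infty_iff_deriv.2 ⟨fun ξ => (hd ξ).differentiableAt, by rwa [hderiv]⟩
    -- To the left of `a'` nothing has been integrated yet; to the right of `b'` the whole integral
    -- of `g`, namely zero, has been.
    have hφ0 : ∀ ξ, ξ ∉ Icc a' b' → φ ξ = 0 := by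
      intro ξ hξ
      by_cases h1 : a' ≤ ξ
      · have h2 : b' < ξ := by
          by_contra h2
          exact hξ ⟨h1, not_lt.1 h2⟩
        rw [hφ]
        simp only
        rw [intervalIntegral.integral_eq_integral_of_support_subset, hgi]
        intro η hη
        have hηK : η ∈ K := by
          by_contra h3
          exact hη (hg0 η h3)
        exact ⟨(hKs hηK).1, (hb' hηK).trans h2.le⟩
      · refine (intervalIntegral.integral_congr fun η hη => ?_).trans intervalIntegral.integral_zero
        refine hg0 η fun hηK => ?_
        have h3 : a' ≤ η := ha' hηK
        have h4 : η ≤ max a ξ := hη.2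
        rcases le_max_iff.1 h4 with h5 | h5
        · exact absurd (hKs ha'K).1 (not_lt.2 (h3.trans h5))
        · exact h1 (h3.trans h5)
    have hφt : tsupport φ ⊆ Ioo a b := by
      have : tsupport φ ⊆ Icc a' b' := by
        refine closure_minimal (fun ξ hξ => ?_) isClosed_Icc
        by_contra h1
        exact hξ (hφ0 ξ h1)
      exact this.trans fun ξ hξ => ⟨(hKs ha'K).1.trans_le hξ.1, hξ.2.trans_lt (hKs hb'K).2⟩
    have h1 := h φ hφs hφt
    rw [hderiv] at h1
    have h2 : ∫ ξ in Icc a b, w ξ * g ξ = (∫ ξ in Icc a b, w ξ * ψ ξ) - m * c := by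
      rw [hc, ← integral_const_mul, ← integral_sub (hwi hψ.continuous)
        ((hwi hρs.continuous).const_mul m)]
      refine integral_congr_ae (Eventually.of_forall fun ξ => ?_)
      simp only [hg]
      ring
    have h3 : ∫ ξ, ψ ξ • (w ξ - c) = ∫ ξ in Icc a b, ψ ξ • (w ξ - c) :=
      (setIntegral_eq_integral_of_forall_compl_eq_zero fun ξ hξ => by
        rw [hzero hψt ξ hξ, zero_smul]).symm
    have h4 : m = ∫ ξ in Icc a b, ψ ξ :=
      (setIntegral_eq_integral_of_forall_compl_eq_zero fun ξ hξ => hzero hψt ξ hξ).symm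
    have h5 : ∫ ξ in Icc a b, ψ ξ • (w ξ - c) = (∫ ξ in Icc a b, w ξ * ψ ξ) - m * c := by
      rw [h4, ← integral_mul_const, ← integral_sub (hwi hψ.continuous)
        (hψi.integrableOn.mul_const c)]
      refine integral_congr_ae (Eventually.of_forall fun ξ => ?_)
      simp only [smul_eq_mul]
      ring
    rw [h3, h5, ← h2, h1]
  have hIcc : w =ᵐ[volume.restrict (Icc a b)] fun _ => c := by
    rw [← Measure.restrict_congr_set (Ioo_ae_eq_Icc (μ := volume) (a := a) (b := b))]
    refine (ae_restrict_iff' measurableSet_Ioo).2 ?_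
    filter_upwards [hae] with ξ hξ hm using sub_eq_zero.1 (hξ hm)
  have heq := Measure.eqOn_Icc_of_ae_eq volume hab.ne hIcc hw continuousOn_const
  intro ξ hξ
  rw [heq hξ, heq ⟨le_rfl, hab.le⟩]

end DuBoisReymond

/-! ### Primitives as integrals of translates -/

noncomputable section DelayGenerator

variable {d : ℝ}

/-- The primitive `ξ ↦ ∫_{-d}^ξ y` of a function on `[-d,0]`. -/
def delayPrimitive (y : DelayL2 d) (ξ : ℝ) : ℝ := ∫ η in (-d)..ξ, zeroExt y η

theorem continuous_delayPrimitive (y : DelayL2 d) : Continuous (delayPrimitive y) :=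
  intervalIntegral.continuous_primitive (intervalIntegrable_zeroExt y) (-d)

/-- Substituting `η = ξ - s` gives an integral starting at `ξ - d ≤ -d`; the excess piece lies
outside the support of the extension. -/
theorem delayPrimitive_eq_integral_sub (y : DelayL2 d) {ξ : ℝ} (hξ : ξ ≤ 0) :
    delayPrimitive y ξ = ∫ s in (0 : ℝ)..d, zeroExt y (ξ - s) := by
  have h0 : ∀ᵐ η : ℝ, η ≠ -d := by simp [ae_iff]
  have h1 : ∫ η in (ξ - d)..(-d), zeroExt y η = 0 := by
    refine intervalIntegral.integral_zero_ae ?_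
    filter_upwards [h0] with η hne hη
    rw [uIoc_of_le (by linarith)] at hη
    exact zeroExt_of_notMem y fun h => hne (le_antisymm hη.2 h.1)
  rw [intervalIntegral.integral_comp_sub_left, sub_zero,
    ← intervalIntegral.integral_add_adjacent_intervals (intervalIntegrable_zeroExt y _ (-d))
      (intervalIntegrable_zeroExt y _ _), h1, zero_add]
  rfl

/-- Integrating the translates of `y` yields its primitive. -/
theorem integral_delayShift (hd : 0 ≤ d) (y : DelayL2 d) :
    (∫ s in (0 : ℝ)..d, delayShift d s y : DelayL2 d)
      =ᵐ[volume.restrict (Icc (-d) 0)] delayPrimitive y := by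
  have hi : IntervalIntegrable (fun s => delayShift d s y) volume 0 d :=
    (continuous_delayShift y).intervalIntegrable _ _
  -- The left side is an `L²`-valued integral. Pairing it with indicators makes it scalar, and
  -- Fubini then yields the pointwise formula.
  refine Integrable.ae_eq_of_forall_setIntegral_eq _ _
    ((Lp.memLp _).integrable (by norm_num))
    (continuous_delayPrimitive y).integrableOn_Icc fun A hA _ => ?_
  have e1 : ∀ x : DelayL2 d, ∫ ξ in A, x ξ ∂(volume.restrict (Icc (-d) 0))
      = ⟪indicatorConstLp 2 (μ := volume.restrict (Icc (-d) 0)) hA (measure_ne_top _ _) (1 : ℝ),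
        x⟫_ℝ := fun x => (L2.inner_indicatorConstLp_one hA (measure_ne_top _ _) x).symm
  have e2 : ∀ s, ∫ ξ in A, delayShift d s y ξ ∂(volume.restrict (Icc (-d) 0))
      = ∫ ξ in A, zeroExt y (ξ - s) ∂(volume.restrict (Icc (-d) 0)) := fun s =>
    integral_congr_ae (ae_restrict_of_ae (delayShift_coeFn s y))
  rw [e1, inner_intervalIntegral_right hi]
  simp_rw [← e1, e2]
  have hint : Integrable (Function.uncurry fun s ξ : ℝ => zeroExt y (ξ - s))
      ((volume.restrict (uIoc 0 d)).prod ((volume.restrict (Icc (-d) 0)).restrict A)) := by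
    have h1 : Integrable (fun _ : ℝ => (1 : ℝ)) (volume.restrict (uIoc 0 d)) :=
      integrableOn_const (by rw [uIoc_of_le hd]; exact measure_Ioc_lt_top.ne)
    -- Joint integrability of `(s, ξ) ↦ y(ξ - s)` is that of a convolution integrand whose first
    -- factor is the constant `1` on `(0,d]`.
    have h2 := (h1.convolution_integrand (ContinuousLinearMap.mul ℝ ℝ)
      (integrable_zeroExt y)).swap
    have h3 : Integrable (Function.uncurry fun s ξ : ℝ => zeroExt y (ξ - s))
        ((volume.restrict (uIoc 0 d)).prod volume) := by
      refine h2.congr (Eventually.of_forall fun p => ?_)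
      simp [Function.uncurry]
    exact h3.mono_measure (Measure.prod_mono le_rfl
      (Measure.restrict_le_self.trans Measure.restrict_le_self))
  rw [intervalIntegral_integral_swap hint]
  refine integral_congr_ae ?_
  filter_upwards [ae_restrict_of_ae (ae_restrict_mem (measurableSet_Icc (a := -d) (b := 0)))]
    with ξ hξ
  exact (delayPrimitive_eq_integral_sub y hξ.2).symm

end DelayGenerator

/-! ### The generator of the delay semigroup -/

section DelayGraph

variable {d : ℝ}

/-- Integration by parts for primitives of functions in `L²(-d,0)`. -/
theorem integral_delayPrimitive_mul_deriv (hd : 0 < d) (y : DelayL2 d) {φ : ℝ → ℝ}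
    (hφ : ContDiff ℝ ∞ φ) (hφt : tsupport φ ⊆ Ioo (-d) 0) :
    ∫ ξ in Icc (-d) 0, delayPrimitive y ξ * deriv φ ξ = -∫ ξ in Icc (-d) 0, y ξ * φ ξ := by
  have hd' : -d ≤ 0 := by linarith
  have hφ0 : φ 0 = 0 := image_eq_zero_of_notMem_tsupport fun h => lt_irrefl _ (hφt h).2
  have hdc : Continuous (deriv φ) := hφ.continuous_deriv (by simp)
  have hint : Integrable (Function.uncurry fun τ σ : ℝ => zeroExt y σ * deriv φ τ)
      ((volume.restrict (Ioc (-d) 0)).prod (volume.restrict (Ioc (-d) 0))) := by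
    have h1 : Integrable (deriv φ) (volume.restrict (Ioc (-d) 0)) :=
      hdc.integrableOn_Icc.mono_set Ioc_subset_Icc_self
    refine (h1.mul_prod (integrable_zeroExt y).restrict).congr (Eventually.of_forall fun p => ?_)
    exact mul_comm _ _
  have h1 := intervalIntegral_triangle_swap hd' hint
  have h2 : ∫ τ in (-d)..0, ∫ σ in (-d)..τ, zeroExt y σ * deriv φ τ
      = ∫ ξ in Icc (-d) 0, delayPrimitive y ξ * deriv φ ξ := by
    rw [intervalIntegral.integral_of_le hd', ← integral_Icc_eq_integral_Ioc]
    simp only [intervalIntegral.integral_mul_const]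
    rfl
  have h3 : ∫ σ in (-d)..0, ∫ τ in σ..0, zeroExt y σ * deriv φ τ
      = -∫ ξ in Icc (-d) 0, y ξ * φ ξ := by
    rw [intervalIntegral.integral_of_le hd', ← integral_Icc_eq_integral_Ioc, ← integral_neg]
    refine setIntegral_congr_fun measurableSet_Icc fun σ hσ => ?_
    rw [intervalIntegral.integral_const_mul, intervalIntegral.integral_deriv_eq_sub
      (fun ξ _ => (hφ.differentiable (by simp)).differentiableAt) (hdc.intervalIntegrable _ _), hφ0,
      zeroExt_of_mem y hσ]
    ring
  rw [← h2, h1, h3]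

/-- The graph of the delay operator in terms of primitives. -/
theorem delayOperatorGraph_iff (hd : 0 < d) (x y : DelaySpace d) :
    delayOperatorGraph d x y ↔
      (x.snd =ᵐ[volume.restrict (Icc (-d) 0)] fun ξ => -delayPrimitive y.snd ξ) ∧
        y.fst = -delayPrimitive y.snd 0 := by
  have hneg : ∀ φ : ℝ → ℝ, -∫ ξ in Icc (-d) 0, (-y.snd : DelayL2 d) ξ * φ ξ
      = ∫ ξ in Icc (-d) 0, y.snd ξ * φ ξ := by
    intro φ
    rw [← integral_neg]
    refine integral_congr_ae ?_
    filter_upwards [Lp.coeFn_neg y.snd] with ξ hξ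
    rw [hξ, Pi.neg_apply, neg_mul, neg_neg]
  have hprim : delayPrimitive y.snd (-d) = 0 := intervalIntegral.integral_same
  constructor
  · rintro ⟨hw, u, hu, hxu, hud, hy0⟩
    -- The weak derivative of `u` is `-y₁`, so adding the primitive of `y₁` leaves a function with
    -- zero weak derivative. Both summands vanish at `-d`.
    have hconst : ∀ ξ ∈ Icc (-d) 0, u ξ + delayPrimitive y.snd ξ
        = u (-d) + delayPrimitive y.snd (-d) := by
      refine eqOn_const_of_integral_mul_deriv_eq_zero
        (w := fun ξ => u ξ + delayPrimitive y.snd ξ) (by linarith)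
        (hu.add (continuous_delayPrimitive _).continuousOn) fun φ hφ hφt => ?_
      have hdc : Continuous (deriv φ) := hφ.continuous_deriv (by simp)
      have h1 := hw φ hφ hφt
      rw [hneg] at h1
      have h2 : ∫ ξ in Icc (-d) 0, x.snd ξ * deriv φ ξ
          = ∫ ξ in Icc (-d) 0, u ξ * deriv φ ξ :=
        integral_congr_ae (by filter_upwards [hxu] with ξ hξ; rw [hξ])
      have i1 : IntegrableOn (fun ξ => u ξ * deriv φ ξ) (Icc (-d) 0) :=
        (hu.mul hdc.continuousOn).integrableOn_Icc
      have i2 : IntegrableOn (fun ξ => delayPrimitive y.snd ξ * deriv φ ξ) (Icc (-d) 0) :=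
        ((continuous_delayPrimitive _).mul hdc).integrableOn_Icc
      simp only [add_mul]
      rw [integral_add i1 i2, ← h2, h1, integral_delayPrimitive_mul_deriv hd _ hφ hφt]
      ring
    have hu' : ∀ ξ ∈ Icc (-d) 0, u ξ = -delayPrimitive y.snd ξ := by
      intro ξ hξ
      have := hconst ξ hξ
      rw [hud, hprim] at this
      linarith
    refine ⟨?_, by rw [hy0, hu' 0 ⟨by linarith, le_rfl⟩]⟩
    filter_upwards [hxu, ae_restrict_mem measurableSet_Icc] with ξ hξ hm
    rw [hξ, hu' ξ hm]
  · rintro ⟨hx, hy0⟩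
    refine ⟨fun φ hφ hφt => ?_, fun ξ => -delayPrimitive y.snd ξ,
      (continuous_delayPrimitive _).neg.continuousOn, hx, by simp [hprim], hy0⟩
    rw [hneg]
    have h1 : ∫ ξ in Icc (-d) 0, x.snd ξ * deriv φ ξ
        = ∫ ξ in Icc (-d) 0, -(delayPrimitive y.snd ξ * deriv φ ξ) :=
      integral_congr_ae (by filter_upwards [hx] with ξ hξ; rw [hξ, neg_mul])
    rw [h1, integral_neg, integral_delayPrimitive_mul_deriv hd _ hφ hφt, neg_neg]

theorem ae_eq_neg_delayPrimitive_iff (hd : 0 ≤ d) (x y : DelayL2 d) :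
    (x =ᵐ[volume.restrict (Icc (-d) 0)] fun ξ => -delayPrimitive y ξ) ↔
      x = -∫ s in (0 : ℝ)..d, delayShift d s y := by
  have h : (-∫ s in (0 : ℝ)..d, delayShift d s y : DelayL2 d)
      =ᵐ[volume.restrict (Icc (-d) 0)] fun ξ => -delayPrimitive y ξ :=
    (Lp.coeFn_neg _).trans (integral_delayShift hd y).neg
  exact ⟨fun hx => Lp.ext (hx.trans h.symm), fun hx => hx ▸ h⟩

theorem tendsto_average_integral {X : Type*} [NormedAddCommGroup X] [NormedSpace ℝ X]
    [CompleteSpace X] {f : ℝ → X} (hf : Continuous f) :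
    Tendsto (fun h : ℝ => h⁻¹ • ∫ s in (0 : ℝ)..h, f s) (𝓝[>] 0) (𝓝 (f 0)) := by
  have h1 := (hf.integral_hasStrictDerivAt 0 0).hasDerivAt
  rw [hasDerivAt_iff_tendsto_slope_zero] at h1
  simp only [zero_add, intervalIntegral.integral_same, sub_zero] at h1
  exact h1.mono_left (nhdsWithin_mono _ fun h hh => ne_of_gt hh)

/-- Convergence of difference quotients of translates. -/
theorem tendsto_delayShift_iff (hd : 0 < d) (x y : DelayL2 d) :
    Tendsto (fun h : ℝ => h⁻¹ • (delayShift d h x - x)) (𝓝[>] 0) (𝓝 y) ↔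
      x = -∫ s in (0 : ℝ)..d, delayShift d s y := by
  have hi : ∀ a b, IntervalIntegrable (fun s => delayShift d s y) volume a b := fun a b =>
    (continuous_delayShift y).intervalIntegrable _ _
  constructor
  · intro hlim
    -- The semigroup law carries the right derivative at `0` to every later time. Integrating over
    -- `[0,d]`, where the orbit ends at `0`, recovers `x`.
    have hderiv : ∀ t ∈ Ioo 0 d,
        HasDerivWithinAt (fun t => delayShift d t x) (delayShift d t y) (Ioi t) t := by
      intro t ht
      rw [hasDerivWithinAt_iff_tendsto_slope' (by simp)]
      have h1 := ((delayShift d t).continuous.tendsto y).comp hlim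
      have h2 : Tendsto (fun s : ℝ => s - t) (𝓝[>] t) (𝓝[>] 0) := by
        refine tendsto_nhdsWithin_of_tendsto_nhds_of_eventually_within _ ?_ ?_
        · have : Continuous fun s : ℝ => s - t := by fun_prop
          simpa using (this.tendsto t).mono_left nhdsWithin_le_nhds
        · filter_upwards [self_mem_nhdsWithin] with s hs using mem_Ioi.2 (sub_pos.2 (mem_Ioi.1 hs))
      refine (h1.comp h2).congr' ?_
      filter_upwards [self_mem_nhdsWithin] with s hs
      have hs' : 0 ≤ s - t := (sub_pos.2 (mem_Ioi.1 hs)).le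
      simp only [Function.comp_apply, slope_def_module, _root_.map_smul, _root_.map_sub]
      rw [← delayShift_add ht.1.le hs', add_sub_cancel]
    have h3 := intervalIntegral.integral_eq_sub_of_hasDeriv_right_of_le hd.le
      (continuous_delayShift x).continuousOn hderiv (hi 0 d)
    rw [delayShift_eq_zero le_rfl, delayShift_zero, zero_sub] at h3
    rw [h3, neg_neg]
  · intro hx
    -- Translating `∫₀ᵈ` by `h` moves the window to `[h, d + h]`. Beyond `d` the integrand is zero,
    -- so only `[0,h]` remains in the difference.
    have key : ∀ h : ℝ, 0 ≤ h → delayShift d h x - x = ∫ s in (0 : ℝ)..h, delayShift d s y := by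
      intro h hh
      have e1 : delayShift d h (∫ s in (0 : ℝ)..d, delayShift d s y)
          = ∫ s in h..(d + h), delayShift d s y := by
        have hsh := intervalIntegral.integral_comp_add_right (a := 0) (b := d)
          (fun s => delayShift d s y) h
        rw [zero_add] at hsh
        rw [← (delayShift d h).intervalIntegral_comp_comm (hi 0 d), ← hsh]
        refine intervalIntegral.integral_congr fun s hs => ?_
        rw [uIcc_of_le hd.le] at hs
        simp only [add_comm s h]
        rw [delayShift_add hh hs.1]
      have e2 : ∫ s in d..(d + h), delayShift d s y = 0 := by
        refine (intervalIntegral.integral_congr fun s hs => ?_).trans intervalIntegral.integral_zero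
        rw [uIcc_of_le (by linarith)] at hs
        exact delayShift_eq_zero hs.1 y
      rw [hx, _root_.map_neg, e1,
        ← intervalIntegral.integral_add_adjacent_intervals (hi h d) (hi d (d + h)), e2,
        ← intervalIntegral.integral_add_adjacent_intervals (hi 0 h) (hi h d)]
      abel
    have h1 := tendsto_average_integral (continuous_delayShift y)
    rw [delayShift_zero] at h1
    refine h1.congr' ?_
    filter_upwards [self_mem_nhdsWithin] with h hh
    rw [key h (le_of_lt hh)]

/-- The quotient is the mean over `(-h,0)` of a function with a continuous representative, so it
converges to the boundary value `x₁(0)`. -/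
theorem tendsto_delayMass (hd : 0 < d) {x y : DelayL2 d}
    (hx : x =ᵐ[volume.restrict (Icc (-d) 0)] fun ξ => -delayPrimitive y ξ) :
    Tendsto (fun h : ℝ => h⁻¹ * delayMass d h x) (𝓝[>] 0) (𝓝 (-delayPrimitive y 0)) := by
  have h1 := tendsto_average_integral (f := fun s => -delayPrimitive y (-s))
    ((continuous_delayPrimitive y).comp continuous_neg).neg
  simp only [neg_zero] at h1
  refine h1.congr' ?_
  filter_upwards [Ioc_mem_nhdsGT hd] with h hh
  rw [smul_eq_mul, delayMass_apply hh.1.le,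
    intervalIntegral.integral_comp_neg (fun ξ => -delayPrimitive y ξ), neg_zero]
  congr 1
  refine intervalIntegral.integral_congr_ae ?_
  filter_upwards [(ae_restrict_iff' measurableSet_Icc).1 hx] with ξ hξ hm
  rw [uIoc_of_le (by linarith [hh.1])] at hm
  have hm' : ξ ∈ Icc (-d) 0 := ⟨by linarith [hm.1, hh.2], hm.2⟩
  rw [zeroExt_of_mem x hm', hξ hm']

/-- The delay operator generates the delay semigroup. -/
theorem isGeneratorGraph_delaySemigroup (hd : 0 < d) :
    IsGeneratorGraph (delaySemigroup d) (delayOperatorGraph d) := by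
  intro x y
  have hcomp : Tendsto (fun h : ℝ => h⁻¹ • (delaySemigroup d h x - x)) (𝓝[>] 0) (𝓝 y) ↔
      Tendsto (fun h : ℝ => h⁻¹ * delayMass d h x.snd) (𝓝[>] 0) (𝓝 y.fst) ∧
        Tendsto (fun h : ℝ => h⁻¹ • (delayShift d h x.snd - x.snd)) (𝓝[>] 0) (𝓝 y.snd) := by
    have e : (fun h : ℝ => h⁻¹ • (delaySemigroup d h x - x)) = fun h =>
        (WithLp.prodContinuousLinearEquiv 2 ℝ ℝ (DelayL2 d)).symm
          (h⁻¹ * delayMass d h x.snd, h⁻¹ • (delayShift d h x.snd - x.snd)) := by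
      ext1 h
      rw [delaySemigroup_apply]
      refine (WithLp.prodContinuousLinearEquiv 2 ℝ ℝ (DelayL2 d)).injective ?_
      refine Prod.ext ?_ rfl
      change h⁻¹ * (x.fst + delayMass d h x.snd - x.fst) = h⁻¹ * delayMass d h x.snd
      rw [add_sub_cancel_left]
    have ey : y = (WithLp.prodContinuousLinearEquiv 2 ℝ ℝ (DelayL2 d)).symm (y.fst, y.snd) := rfl
    rw [e]
    conv_lhs => rw [ey]
    rw [← Prod.tendsto_iff (fun h : ℝ =>
      (h⁻¹ * delayMass d h x.snd, h⁻¹ • (delayShift d h x.snd - x.snd))) (y.fst, y.snd)]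
    exact ((WithLp.prodContinuousLinearEquiv 2 ℝ ℝ
      (DelayL2 d)).symm.toHomeomorph.isInducing.tendsto_nhds_iff).symm
  rw [hcomp, delayOperatorGraph_iff hd, tendsto_delayShift_iff hd,
    ← ae_eq_neg_delayPrimitive_iff hd.le]
  -- Convergence of the `L²` component already makes `x₁` a primitive. The scalar limit then exists
  -- and is forced to be `x₁(0)`.
  constructor
  · rintro ⟨hx, hy⟩
    exact ⟨hy ▸ tendsto_delayMass hd hx, hx⟩
  · rintro ⟨hlim, hx⟩
    exact ⟨hx, tendsto_nhds_unique hlim (tendsto_delayMass hd hx)⟩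

end DelayGraph

/-! ### The theorem -/

theorem mainTheorem6
    (d T β γ η r σ : ℝ) (hd : 0 < d) (hT : 0 < T) (hβ : 0 < β) (hγ : 0 < γ) (hη : 0 < η)
    (hr : 0 < r) (b : DelayL2 d) (hb : 0 ≤ b)
    [MeasurableSpace (DelaySpace d)] [BorelSpace (DelaySpace d)]
    (m₀ : Measure (DelaySpace d)) [IsProbabilityMeasure m₀]
    (hm₀ : Integrable (fun x : DelaySpace d => x) m₀) :
    (∃ E : ℝ → DelaySpace d →L[ℝ] DelaySpace d,
      IsC0Semigroup E ∧ IsGeneratorGraph E (delayOperatorGraph d)) ∧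
    ∀ E : ℝ → DelaySpace d →L[ℝ] DelaySpace d,
      IsC0Semigroup E → IsGeneratorGraph E (delayOperatorGraph d) →
      (∃ (P : ℝ → DelaySpace d →L[ℝ] DelaySpace d) (ρ z : ℝ → DelaySpace d) (s : ℝ → ℝ),
        (productionData d β γ η r σ b).IsLQMMildSolution E T (∫ x, x ∂m₀) P ρ z s) ∧
      ∀ (P P' : ℝ → DelaySpace d →L[ℝ] DelaySpace d) (ρ ρ' z z' : ℝ → DelaySpace d)
        (s s' : ℝ → ℝ),
        (productionData d β γ η r σ b).IsLQMMildSolution E T (∫ x, x ∂m₀) P ρ z s →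
        (productionData d β γ η r σ b).IsLQMMildSolution E T (∫ x, x ∂m₀) P' ρ' z' s' →
        ∀ t ∈ Icc 0 T, P t = P' t ∧ ρ t = ρ' t ∧ z t = z' t ∧ s t = s' t := by
  have hD := isRankOne_productionData d β γ η hr σ b
  -- The sign of the coupling is the monotonicity that makes the forward-backward system uniquely
  -- solvable for every horizon.
  have hc : 0 ≤ β * γ := (mul_pos hβ hγ).le
  exact ⟨⟨delaySemigroup d, isC0Semigroup_delaySemigroup d, isGeneratorGraph_delaySemigroup hd⟩,
    fun E hE _ => ⟨hD.exists_solution hc hE hT.le _,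
      fun P P' ρ ρ' z z' s s' h h' => hD.solution_unique hc hE hT.le h h'⟩⟩
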